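/- **Setting.** Let $(C_n)_{n\ge1}$ and $(F_n)_{n\ge0}$ be sequences of finite subsets of $\mathbb Z$ with $F_0=\{0\}$, $\#C_n>1$, $F_n+C_{n+1}\subset F_{n+1}$ and $(F_n+c)\cap(F_n+c')=\emptyset$ for distinct $c,c'\in C_{n+1}$. Let $X$ be the inductive limit of the compact spaces $X_n=F_n\times C_{n+1}\times C_{n+2}\times\cdots$ under the embeddings $(f_n,c_{n+1},c_{n+2},\dots)\mapsto(f_n+c_{n+1},c_{n+2},\dots)$, with cylinders $[A]_n=\{(f_n,c_{n+1},\dots)\in X_n: f_n\in A\}$ and $[f]_n=[\{f\}]_n$, and let $\mu$ be the Borel measure on $X$ whose restriction to each $X_n$ is $(\#C_1\cdots\#C_n)^{-1}$ times the product of the counting measure on $F_n$ and the uniform probability measures on $C_{n+1},C_{n+2},\dots$ (so $\mu([0]_0)=1$). For $g\in\mathbb Z$ put $T_g(f_n,c_{n+1},\dots)=(g+f_n,c_{n+1},\dots)$ whenever $f_n,\,g+f_n\in F_n$; this is an action of $\mathbb Z$ on the set $X^{\mathbb Z}$ of points at which every $T_g$ is defined (the $(C,F)$-action). Assume that for all $g\in\mathbb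 Z$ and $n>0$ $$\lim_{m\to\infty}\frac{\#\big((g+F_n+C_{n+1}+\cdots+C_m)\cap F_m\big)}{\#F_n\,\#C_{n+1}\cdots\#C_m}=1$$ (i.e. $T$ is defined almost everywhere). **Definitions.** A measure preserving, conservative, ergodic $\mathbb Z$-action $T$ on a $\sigma$-finite measure space $(X,\mu)$ is *subsequence weakly rationally ergodic* if there are a strictly increasing sequence $(h_n)$ of non-negative integers and a set $Y$ with $0<\mu(Y)<\infty$ such that, with $a_n(Y)=\sum_{k=0}^{h_n-1}\mu(Y\cap T_kY)/\mu(Y)^2$, one has $\frac1{a_n(Y)}\sum_{k=0}^{h_n-1}\mu(A\cap T_kB)\to\mu(A)\mu(B)$ for all measurable $A,B\subset Y$. It is *non-squashable* if every nonsingular transformation (invertible or not) that commutes with $T$ almost everywhere preserves $\mu$. A measure preserving $\mathbb Z$-action $T$ on $(X,\mu)$ is *of rank one* if there are measurable sets $B_n$ of finite measure and integers $h_n\ge0$ such that, for each $n$, the sets $T_kB_n$, $0\le k<h_n$, are pairwise disjoint and, for every measurable $B$ with $\mu(B)<\infty$, $\min_{F\subset\{0,\dots,h_n-1\}}\mu\big(B\,\triangle\bigsqcup_{k\in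 F}T_kB_n\big)\to0$. **Theorem 2.4.** (1) Let $T$ be a $(C,F)$-action as above with $F_n=\{0,\dots,h_n-1\}$ for all $n$. Then for all Borel subsets $A,B\subset[0]_0$, $$\lim_{l\to\infty}\frac{\sum_{k=0}^{h_l-1}\mu(A\cap T_kB)}{\sum_{k=0}^{h_l-1}\mu([0]_0\cap T_k[0]_0)}=\mu(A)\mu(B).$$ Moreover $T$ (on $X^{\mathbb Z}$ with the restriction of $\mu$) is subsequence weakly rationally ergodic and non-squashable. (2) Every rank-one measure preserving action of $\mathbb Z$ on a non-atomic standard $\sigma$-finite space of non-zero (in particular, of infinite) measure is subsequence weakly rationally ergodic and non-squashable. -/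

import Mathlib

open MeasureTheory Filter Topology Set
open scoped Pointwise ENNReal

/-! ## Notions for measure preserving `ℤ`-actions -/

section Actions

variable {X : Type*} [MeasurableSpace X] [AddAction ℤ X]

/-- The sum `∑_{0 ≤ k < n} μ (A ∩ T_k B)`. -/
noncomputable def returnSum (μ : Measure X) (A B : Set X) (n : ℕ) : ℝ :=
  ∑ k ∈ Finset.range n, μ.real (A ∩ ((k : ℤ) +ᵥ B))

/-- Weak rational ergodicity of a `ℤ`-action along the sets `F_n = {0, …, h n - 1}`: the action is a
conservative ergodic measure preserving action on a `σ`-finite space and there is a set `Y` of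
finite positive measure such that, with `a_n(Y) = ∑_{k ∈ F_n} μ(Y ∩ T_k Y) / μ(Y)^2`,
`(1 / a_n(Y)) ∑_{k ∈ F_n} μ(A ∩ T_k B) → μ(A) μ(B)` for all measurable `A, B ⊆ Y`. -/
def IsWeaklyRationallyErgodicAlong (μ : Measure X) (h : ℕ → ℕ) : Prop :=
  SigmaFinite μ ∧ ErgodicVAdd ℤ X μ ∧ Conservative (fun x : X => (1 : ℤ) +ᵥ x) μ ∧
    ∃ Y : Set X, MeasurableSet Y ∧ 0 < μ Y ∧ μ Y < ∞ ∧
      ∀ A B : Set X, MeasurableSet A → MeasurableSet B → A ⊆ Y → B ⊆ Y →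
        Tendsto (fun n => (1 / (returnSum μ Y Y (h n) / μ.real Y ^ 2)) * returnSum μ A B (h n))
          atTop (𝓝 (μ.real A * μ.real B))

/-- Subsequence weak rational ergodicity. -/
def IsSubsequenceWeaklyRationallyErgodic (μ : Measure X) : Prop :=
  ∃ h : ℕ → ℕ, StrictMono h ∧ IsWeaklyRationallyErgodicAlong μ h

/-- Non-squashability: every nonsingular transformation `S` (not assumed to be invertible) that
commutes with the action almost everywhere preserves the measure. -/
def IsNonSquashable (μ : Measure X) : Prop :=
  ∀ S : X → X, Measure.QuasiMeasurePreserving S μ μ →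
    (∀ k : ℤ, ∀ᵐ x ∂μ, S (k +ᵥ x) = k +ᵥ S x) → MeasurePreserving S μ μ

/-- Rank one: there are measurable sets `B n` of finite measure and heights `h n` such that
`T_k (B n)`, `0 ≤ k < h n`, are pairwise disjoint, and every measurable set of finite measure is
approximated by unions of levels of the `n`-th tower as `n → ∞`. -/
def IsRankOne (μ : Measure X) : Prop :=
  ∃ (B : ℕ → Set X) (h : ℕ → ℕ),
    (∀ n, MeasurableSet (B n) ∧ μ (B n) < ∞) ∧
    (∀ n, ∀ i < h n, ∀ j < h n, i ≠ j → Disjoint ((i : ℤ) +ᵥ B n) ((j : ℤ) +ᵥ B n)) ∧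
    ∀ A : Set X, MeasurableSet A → μ A < ∞ →
      Tendsto (fun n => ⨅ F ∈ (Finset.range (h n)).powerset,
        μ (symmDiff A (⋃ k ∈ F, (k : ℤ) +ᵥ B n))) atTop (𝓝 0)

end Actions

/-! ## The `(C,F)`-construction over `ℤ` -/

/-- A `(C,F)`-sequence in `ℤ`. Only the sets `C n` with `n ≥ 1` matter. -/
structure CFSequence where
  F : ℕ → Finset ℤ
  C : ℕ → Finset ℤ
  F_zero : F 0 = {0}
  one_lt_card : ∀ n, 1 < (C (n + 1)).card
  add_subset : ∀ n, F n + C (n + 1) ⊆ F (n + 1)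
  disjoint : ∀ n, ∀ c ∈ C (n + 1), ∀ c' ∈ C (n + 1), c ≠ c' →
    Disjoint (F n + {c}) (F n + {c'})

namespace CFSequence

variable (D : CFSequence)

/-- `X_n = F_n × C_{n+1} × C_{n+2} × ⋯`, as a subspace of `ℤ × ℤ^ℕ` (with the subspace topology,
which is the infinite product topology of the finite discrete factors). -/
abbrev Level (n : ℕ) : Type :=
  {p : ℤ × (ℕ → ℤ) // p.1 ∈ D.F n ∧ ∀ i, p.2 i ∈ D.C (n + 1 + i)}

/-- `(f, c_1, c_2, …) ↦ (f + c_1, c_2, …)`: the embedding of `X_n` into `X_{n+1}`, for all `n`. -/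
def step (p : ℤ × (ℕ → ℤ)) : ℤ × (ℕ → ℤ) := (p.1 + p.2 0, fun i => p.2 (i + 1))

/-- Two points `u ∈ X_n`, `v ∈ X_m` are identified when they have the same image in some `X_k`,
`k ≥ n, m`. -/
def limitSetoid : Setoid (Σ n, D.Level n) where
  r u v := ∃ i j : ℕ, u.1 + i = v.1 + j ∧ step^[i] u.2.1 = step^[j] v.2.1
  iseqv :=
    { refl := fun _ => ⟨0, 0, rfl, rfl⟩
      symm := fun ⟨i, j, h, h'⟩ => ⟨j, i, h.symm, h'.symm⟩
      trans := by
        rintro u v w ⟨i, j, h1, h2⟩ ⟨k, l, h3, h4⟩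
        refine ⟨k + i, j + l, by omega, ?_⟩
        rw [Function.iterate_add_apply, h2, ← Function.iterate_add_apply, Nat.add_comm k j,
          Function.iterate_add_apply, h4, ← Function.iterate_add_apply] }

/-- The `(C,F)`-space `X`, the inductive limit of the `X_n`. -/
def Space : Type := Quotient D.limitSetoid

/-- The inductive limit topology. -/
instance : TopologicalSpace D.Space :=
  inferInstanceAs (TopologicalSpace (Quotient D.limitSetoid))

instance : MeasurableSpace D.Space := borel D.Space

instance : BorelSpace D.Space := ⟨rfl⟩

/-- The canonical map `X_n → X`. -/
def incl (n : ℕ) (u : D.Level n) : D.Space := Quotient.mk D.limitSetoid ⟨n, u⟩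

/-- The `n`-cylinder `[A]_n`. -/
def cylinder (n : ℕ) (A : Set ℤ) : Set D.Space := D.incl n '' {u | u.1.1 ∈ A}

/-- The restriction to `X_n` of the `(C,F)`-measure: counting measure on `F_n` times the product of
the uniform probability measures on `C_{n+1}, C_{n+2}, …`, divided by `#C_1 ⋯ #C_n`. -/
noncomputable def levelMeasure (n : ℕ) : Measure (D.Level n) :=
  (∏ j ∈ Finset.Icc 1 n, ((D.C j).card : ℝ≥0∞))⁻¹ •
    ((Measure.count.restrict (D.F n : Set ℤ)).prod
      (Measure.infinitePi fun i : ℕ =>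
        ProbabilityTheory.uniformOn (D.C (n + 1 + i) : Set ℤ))).comap Subtype.val

/-- The `(C,F)`-measure on `X`, glued from its restrictions to `X_0`, `X_1 \ X_0`, `X_2 \ X_1`, ….
It satisfies `μ ([A]_n) = #A / (#C_1 ⋯ #C_n)` for `A ⊆ F_n`; in particular `μ ([0]_0) = 1`. -/
noncomputable def measure : Measure D.Space :=
  Measure.sum fun n =>
    ((D.levelMeasure n).map (D.incl n)).restrict (disjointed (fun m => range (D.incl m)) n)

/-- `X^g`, the set of points `(f_n, c_{n+1}, …) ∈ X_n`, `n ≥ 0`, with `g + f_n ∈ F_n`. -/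
def dom (g : ℤ) : Set D.Space := ⋃ n, D.incl n '' {u | g + u.1.1 ∈ D.F n}

/-- `X^ℤ`, the set on which the action is defined. -/
def core : Set D.Space := ⋂ g, D.dom g

/-- The translate `(g + f_n, c_{n+1}, …) ∈ X_n` of `(f_n, c_{n+1}, …) ∈ X_n`. -/
def Level.translate {D : CFSequence} {n : ℕ} (g : ℤ) (u : D.Level n) (h : g + u.1.1 ∈ D.F n) :
    D.Level n :=
  ⟨(g + u.1.1, u.1.2), h, u.2.2⟩

theorem step_translate (g : ℤ) (i : ℕ) (p : ℤ × (ℕ → ℤ)) :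
    step^[i] (g + p.1, p.2) = (g + (step^[i] p).1, (step^[i] p).2) := by
  induction i generalizing p with
  | zero => rfl
  | succ i ih =>
    rw [Function.iterate_succ_apply, Function.iterate_succ_apply, ← ih (step p)]
    simp [step, add_assoc]

theorem incl_translate_eq {n m : ℕ} (g : ℤ) (u : D.Level n) (v : D.Level m)
    (hu : g + u.1.1 ∈ D.F n) (hv : g + v.1.1 ∈ D.F m) (h : D.incl n u = D.incl m v) :
    D.incl n (u.translate g hu) = D.incl m (v.translate g hv) := by
  obtain ⟨i, j, h1, h2⟩ := Quotient.exact h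
  refine Quotient.sound ⟨i, j, h1, ?_⟩
  change step^[i] (g + u.1.1, u.1.2) = step^[j] (g + v.1.1, v.1.2)
  change step^[i] u.1 = step^[j] v.1 at h2
  rw [step_translate, step_translate, h2]

theorem exists_of_mem_dom {g : ℤ} {x : D.Space} (hx : x ∈ D.dom g) :
    ∃ (n : ℕ) (u : D.Level n), g + u.1.1 ∈ D.F n ∧ D.incl n u = x := by
  simpa [dom] using hx

/-- The embedding `X_n → X_{n+1}`. -/
def Level.next {D : CFSequence} {n : ℕ} (u : D.Level n) : D.Level (n + 1) :=
  ⟨step u.1, D.add_subset n (Finset.add_mem_add u.2.1 (u.2.2 0)), fun i => by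
    have := u.2.2 (i + 1)
    rwa [show n + 1 + (i + 1) = n + 1 + 1 + i by omega] at this⟩

theorem incl_next {n : ℕ} (u : D.Level n) : D.incl (n + 1) u.next = D.incl n u :=
  Quotient.sound ⟨0, 1, rfl, rfl⟩

theorem add_mem_next {n : ℕ} (g : ℤ) (u : D.Level n) (h : g + u.1.1 ∈ D.F n) :
    g + u.next.1.1 ∈ D.F (n + 1) := by
  have := D.add_subset n (Finset.add_mem_add h (u.2.2 0))
  rwa [show g + u.1.1 + u.1.2 0 = g + u.next.1.1 by simp [Level.next, step, add_assoc]] at this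

theorem exists_level_le {g : ℤ} {n : ℕ} (u : D.Level n) (h : g + u.1.1 ∈ D.F n) (k : ℕ) :
    ∃ v : D.Level (n + k), g + v.1.1 ∈ D.F (n + k) ∧ v.1 = step^[k] u.1 ∧
      D.incl (n + k) v = D.incl n u := by
  induction k with
  | zero => exact ⟨u, h, rfl, rfl⟩
  | succ k ih =>
    obtain ⟨v, h1, h2, h3⟩ := ih
    refine ⟨v.next, D.add_mem_next g v h1, ?_, (D.incl_next v).trans h3⟩
    rw [Function.iterate_succ_apply', ← h2]
    rfl

/-- The sets `X_n^g` increase with `n`, so two of them can be reached at a common level. -/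
theorem exists_common {g g' : ℤ} {x : D.Space} (hx : x ∈ D.dom g) (hx' : x ∈ D.dom g') :
    ∃ (n : ℕ) (u : D.Level n), g + u.1.1 ∈ D.F n ∧ g' + u.1.1 ∈ D.F n ∧ D.incl n u = x := by
  obtain ⟨n, u, hu, rfl⟩ := D.exists_of_mem_dom hx
  obtain ⟨m, v, hv, huv⟩ := D.exists_of_mem_dom hx'
  obtain ⟨i, j, h1, h2⟩ := Quotient.exact huv
  change m + i = n + j at h1
  change step^[i] v.1 = step^[j] u.1 at h2
  obtain ⟨u', a1, a2, a3⟩ := D.exists_level_le u hu j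
  obtain ⟨v', b1, b2, -⟩ := D.exists_level_le v hv i
  refine ⟨n + j, u', a1, ?_, a3⟩
  rw [a2, ← h2, ← b2, ← h1]
  exact b1

/-- `T_g x` for `x ∈ X^g`. -/
noncomputable def act (g : ℤ) (x : D.Space) (hx : x ∈ D.dom g) : D.Space :=
  D.incl _ ((D.exists_of_mem_dom hx).choose_spec.choose.translate g
    (D.exists_of_mem_dom hx).choose_spec.choose_spec.1)

/-- `T_g (f_n, c_{n+1}, …) = (g + f_n, c_{n+1}, …)` whenever `f_n, g + f_n ∈ F_n`. -/
theorem act_eq (g : ℤ) {x : D.Space} (hx : x ∈ D.dom g) {n : ℕ} (u : D.Level n)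
    (hu : g + u.1.1 ∈ D.F n) (h : D.incl n u = x) :
    D.act g x hx = D.incl n (u.translate g hu) :=
  D.incl_translate_eq g _ u _ hu
    ((D.exists_of_mem_dom hx).choose_spec.choose_spec.2.trans h.symm)

theorem act_mem_core (g : ℤ) {x : D.Space} (hx : x ∈ D.core) :
    D.act g x (mem_iInter.1 hx g) ∈ D.core := by
  refine mem_iInter.2 fun g' => ?_
  obtain ⟨n, u, h1, h2, h3⟩ := D.exists_common (mem_iInter.1 hx g) (mem_iInter.1 hx (g' + g))
  rw [D.act_eq g _ u h1 h3]
  refine mem_iUnion.2 ⟨n, u.translate g h1, ?_, rfl⟩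
  change g' + (g + u.1.1) ∈ D.F n
  rwa [← add_assoc]

/-- The `(C,F)`-action `T = (T_g)` of `ℤ` on `X^ℤ`; `g +ᵥ x` is `T_g x`. -/
noncomputable instance : AddAction ℤ D.core where
  vadd g x := ⟨D.act g x.1 (mem_iInter.1 x.2 g), D.act_mem_core g x.2⟩
  zero_vadd x := by
    apply Subtype.ext
    obtain ⟨n, u, h1, h2⟩ := D.exists_of_mem_dom (mem_iInter.1 x.2 0)
    change D.act 0 x.1 (mem_iInter.1 x.2 0) = x.1
    rw [D.act_eq 0 _ u h1 h2, ← h2]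
    congr 1
    apply Subtype.ext
    simp [Level.translate]
  add_vadd g g' x := by
    apply Subtype.ext
    obtain ⟨n, u, h1, h2, h3⟩ :=
      D.exists_common (mem_iInter.1 x.2 g') (mem_iInter.1 x.2 (g + g'))
    change D.act (g + g') x.1 (mem_iInter.1 x.2 (g + g')) =
      D.act g (D.act g' x.1 (mem_iInter.1 x.2 g')) (mem_iInter.1 (D.act_mem_core g' x.2) g)
    have h4 : g + (u.translate g' h1).1.1 ∈ D.F n := by
      change g + (g' + u.1.1) ∈ D.F n
      rwa [← add_assoc]
    rw [D.act_eq (g + g') _ u h2 h3,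
      D.act_eq g _ (u.translate g' h1) h4 (D.act_eq g' _ u h1 h3).symm]
    congr 1
    apply Subtype.ext
    simp [Level.translate, add_assoc]

/-- `T_k B`, the image under `T_k` of the part of `B ⊆ X` that lies in `X^ℤ`. -/
def image (k : ℤ) (B : Set D.Space) : Set D.Space :=
  Subtype.val '' (k +ᵥ (Subtype.val ⁻¹' B : Set D.core))

/-- The `(C,F)`-measure restricted to the domain `X^ℤ` of the action. -/
noncomputable def coreMeasure : Measure D.core := D.measure.comap Subtype.val

/-- For all `g` and `n > 0`, as `m → ∞`,
`#((g + F_n + C_{n+1} + ⋯ + C_m) ∩ F_m) / (#F_n #C_{n+1} ⋯ #C_m) → 1`. This is the condition for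
the `(C,F)`-action to be defined almost everywhere. -/
def IsAlmostEverywhereDefined : Prop :=
  ∀ (g : ℤ) (n : ℕ), 0 < n →
    Tendsto (fun m : ℕ =>
      ((((({g} : Finset ℤ) + D.F n + ∑ j ∈ Finset.Ioc n m, D.C j) ∩ D.F m).card : ℝ) /
        (((D.F n).card : ℝ) * ∏ j ∈ Finset.Ioc n m, ((D.C j).card : ℝ))))
      atTop (𝓝 1)

end CFSequence

/-! Both statements rest on one kind of set. Suppose `Y` has finite positive measure and, for each
`l`, is covered by `N_l` levels of a tower of height `h_l`, the total measure of these levels being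
bounded and `N_l → ∞` (`TowerCover`). Let `s_l = ∑_{k < h_l} μ(Y ∩ T_k Y)`. During a window of
length `h_l` each level is visited at most once, so every point visits `Y` at most `N_l` times
(`IsTower.visits_le`). Conversely, Cauchy–Schwarz on the base of the tower gives `N_l ≤ C s_l`
(`card_mul_sq_le_returnSum`). Therefore, for `E ⊆ Y`, the visit counts of `E` divided by `s_l` are
uniformly bounded functions, and translating the point by `g` changes them by at most `|g| / s_l →
0`. Ergodicity makes such a sequence asymptotically orthogonal to all integrable functions of mean
zero (`tendsto_integral_mul_zero`), and a calibration of the constant yields `s_l⁻¹ ∑_k ∫_{T_k E} f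
→ μ(E) ∫ f / μ(Y)²` for every integrable `f` (`tendsto_window_sum`). The choice `f = 1_A` is weak
rational ergodicity.

Non-squashability uses the same limit. If `S` is nonsingular and commutes with `T`, let `f` be the
density of the image under `S` of `μ` restricted to `Y`. The averages of `μ(Y ∩ T_k S⁻¹A)` then tend
to `μ(A) / μ(Y)`, while computed directly they tend to `μ(S⁻¹A) / μ(Y)`; so `S` preserves the
measure of subsets of `Y`, and by ergodicity of all sets (`isNonSquashable_of_window`).

It remains to supply ergodicity, conservativity and `Y`. The first two follow from approximation by
levels together with bases of measure tending to zero. For a `(C,F)`-action, `Y = [0]_0` is exactly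
a union of levels of every tower (`CFSequence.towerCover`). For a general rank-one action, `Y` is a
set intersected with its own approximations by levels along a fast subsequence
(`RankOneTowers.exists_towerCover`). -/

/-! ### Asymptotically invariant bounded functions under an ergodic action. -/

section Ergodic

/-- The vectors with limit zero form a subspace containing `S`. A vector orthogonal to it is
orthogonal to `S`, hence zero, so the subspace is dense; the uniform norm bound extends the limit to
its closure. -/
theorem tendsto_inner_zero_of_total {H : Type*} [NormedAddCommGroup H] [InnerProductSpace ℝ H]
    [CompleteSpace H] {M : ℕ → H} {R : ℝ} (hR : ∀ l, ‖M l‖ ≤ R) {S : Set H}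
    (hS : ∀ f ∈ S, Tendsto (fun l => inner ℝ (M l) f) atTop (𝓝 0))
    (htot : ∀ v : H, (∀ s ∈ S, inner ℝ s v = 0) → v = 0) (f : H) :
    Tendsto (fun l => inner ℝ (M l) f) atTop (𝓝 0) := by
  let K : Submodule ℝ H :=
    { carrier := {f | Tendsto (fun l => inner ℝ (M l) f) atTop (𝓝 0)}
      add_mem' := fun {a b} ha hb => by
        simpa [inner_add_right] using Tendsto.add ha hb
      zero_mem' := by simp
      smul_mem' := fun c a ha => by
        simpa [inner_smul_right] using Tendsto.const_mul c ha }
  have hperp : Kᗮ = ⊥ := by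
    rw [Submodule.eq_bot_iff]
    exact fun v hv => htot v fun s hs => hv s (hS s hs)
  have hdense : f ∈ K.topologicalClosure := by
    rw [K.topologicalClosure_eq_top_iff.2 hperp]; trivial
  have hR0 : 0 ≤ R := (norm_nonneg _).trans (hR 0)
  rw [Metric.tendsto_atTop]
  intro ε hε
  obtain ⟨g, hg, hfg⟩ := Metric.mem_closure_iff.1 hdense (ε / (2 * (R + 1))) (by positivity)
  obtain ⟨N, hN⟩ := Metric.tendsto_atTop.1 hg (ε / 2) (by positivity)
  refine ⟨N, fun n hn => ?_⟩
  have h1 := hN n hn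
  rw [Real.dist_eq, sub_zero] at h1 ⊢
  have h2 : inner ℝ (M n) f = inner ℝ (M n) (f - g) + inner ℝ (M n) g := by
    rw [← inner_add_right, sub_add_cancel]
  rw [dist_eq_norm] at hfg
  have h3 : |inner ℝ (M n) (f - g)| ≤ ε / 2 := by
    calc |inner ℝ (M n) (f - g)| ≤ ‖M n‖ * ‖f - g‖ := abs_real_inner_le_norm _ _
      _ ≤ (R + 1) * (ε / (2 * (R + 1))) := by
        gcongr
        linarith [hR n]
      _ = ε / 2 := by field_simp
  rw [h2]
  exact (abs_add_le _ _).trans_lt (by linarith)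

variable {X : Type*} [MeasurableSpace X] [AddAction ℤ X] [MeasurableConstVAdd ℤ X]
  {μ : Measure X}

/-- The union of all translates of `P` is invariant and not null, hence conull, so some translate
must charge `M`. -/
theorem measure_vadd_inter_ne_zero_of_ergodic [ErgodicVAdd ℤ X μ] {P M : Set X}
    (hPm : MeasurableSet P) (hP : μ P ≠ 0) (hM : μ M ≠ 0) :
    ∃ g : ℤ, μ ((g +ᵥ P) ∩ M) ≠ 0 := by
  by_contra! hcon
  set U : Set X := ⋃ g : ℤ, g +ᵥ P with hU
  have hUm : MeasurableSet U := MeasurableSet.iUnion fun g => hPm.const_vadd g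
  have hinv : ∀ g : ℤ, g +ᵥ U = U := by
    intro g
    ext x
    simp only [hU, mem_iUnion, Set.mem_vadd_set_iff_neg_vadd_mem]
    constructor
    · rintro ⟨k, hk⟩
      exact ⟨g + k, by rwa [neg_add_rev, add_vadd]⟩
    · rintro ⟨k, hk⟩
      exact ⟨k - g, by rwa [vadd_vadd, show -(k - g) + -g = -k by ring]⟩
  have hc := aeconst_of_forall_vadd_ae_eq ℤ (μ := μ) hUm.nullMeasurableSet
    fun g => by rw [hinv g]; exact ae_eq_refl _
  have hPU : P ⊆ U := fun x hx => mem_iUnion.2 ⟨0, by simpa using hx⟩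
  rcases eventuallyConst_set'.1 hc with h | h
  · exact hP (measure_mono_null hPU (ae_eq_empty.1 h))
  · have h0 : μ Uᶜ = 0 := ae_eq_univ.1 h
    have h1 : μ (⋃ g : ℤ, (g +ᵥ P) ∩ M) = 0 := measure_iUnion_null hcon
    refine hM (measure_mono_null (fun x hx => ?_) (measure_union_null h0 h1))
    by_cases hxU : x ∈ U
    · obtain ⟨g, hg⟩ := mem_iUnion.1 hxU
      exact Or.inr (mem_iUnion.2 ⟨g, hg, hx⟩)
    · exact Or.inl hxU

theorem setIntegral_vadd [VAddInvariantMeasure ℤ X μ] (g : ℤ) (A : Set X) (f : X → ℝ) :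
    ∫ x in g +ᵥ A, f x ∂μ = ∫ x in A, f (g +ᵥ x) ∂μ := by
  have := (measurePreserving_vadd g μ).setIntegral_preimage_emb
    (measurableEmbedding_const_vadd g) f (g +ᵥ A)
  rw [← this]
  congr 2
  ext x
  simp

/-- A bounded, asymptotically invariant sequence of functions is asymptotically orthogonal to
every square integrable function of mean zero on a set of finite measure. -/
theorem tendsto_setIntegral_mul_zero [ErgodicVAdd ℤ X μ] {Y : Set X} (hYm : MeasurableSet Y)
    (hY : μ Y ≠ ∞) {m : ℕ → X → ℝ} (hm : ∀ l, Measurable (m l)) {C : ℝ}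
    (hC : ∀ l x, |m l x| ≤ C)
    (hinv : ∀ g : ℤ, ∀ ε > 0, ∀ᶠ l in atTop, ∀ x, |m l (g +ᵥ x) - m l x| ≤ ε)
    {f : X → ℝ} (hf : MemLp f 2 (μ.restrict Y)) (h0 : ∫ x in Y, f x ∂μ = 0) :
    Tendsto (fun l => ∫ x in Y, f x * m l x ∂μ) atTop (𝓝 0) := by
  have : IsFiniteMeasure (μ.restrict Y) := ⟨by simpa using hY.lt_top⟩
  rcases eq_or_ne (μ Y) 0 with hY0 | hY0
  · simp [Measure.restrict_eq_zero.2 hY0]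
  have hYr : μ.real Y ≠ 0 := by simp [Measure.real, ENNReal.toReal_eq_zero_iff, hY0, hY]
  have hmint : ∀ l (ν : Measure X) [IsFiniteMeasure ν], Integrable (m l) ν := fun l ν _ =>
    Integrable.of_bound (hm l).aestronglyMeasurable C (ae_of_all _ fun x => hC l x)
  have hC0 : 0 ≤ C := by
    obtain ⟨x, -⟩ := nonempty_of_measure_ne_zero hY0
    exact (abs_nonneg _).trans (hC 0 x)
  -- Since `f` has mean zero, subtracting from `m l` its mean over `Y` does not change the
  -- integrals, and it makes the constant function a valid test vector.
  set c : ℕ → ℝ := fun l => (∫ x in Y, m l x ∂μ) / μ.real Y with hc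
  have hcC : ∀ l, |c l| ≤ C := by
    intro l
    have h1 : ‖∫ x in Y, m l x ∂μ‖ ≤ C * μ.real Y :=
      norm_setIntegral_le_of_norm_le_const hY.lt_top fun x _ => hC l x
    rw [hc, abs_div, abs_of_nonneg (measureReal_nonneg (μ := μ) (s := Y))]
    exact (div_le_iff₀ (lt_of_le_of_ne measureReal_nonneg (Ne.symm hYr))).2 h1
  have hb : ∀ l x, ‖m l x - c l‖ ≤ 2 * C := fun l x =>
    (abs_sub _ _).trans (by linarith [hC l x, hcC l])
  have hmem : ∀ l, MemLp (fun x => m l x - c l) 2 (μ.restrict Y) := fun l =>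
    MemLp.of_bound ((hm l).sub measurable_const).aestronglyMeasurable (2 * C)
      (ae_of_all _ (hb l))
  let M : ℕ → Lp ℝ 2 (μ.restrict Y) := fun l => (hmem l).toLp _
  -- The Hilbert space only sees `Y`, so the coboundaries used are those of partial translations:
  -- both `A` and its translate must lie in `Y`.
  let S : Set (Lp ℝ 2 (μ.restrict Y)) :=
    {indicatorConstLp 2 MeasurableSet.univ (measure_ne_top _ _) 1} ∪
    {v | ∃ (g : ℤ) (A : Set X) (hA : MeasurableSet A), A ⊆ Y ∧ g +ᵥ A ⊆ Y ∧
      v = indicatorConstLp 2 hA (measure_ne_top _ _) 1 -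
        indicatorConstLp 2 (hA.const_vadd g) (measure_ne_top _ _) 1}
  have hin : ∀ {A : Set X} (hA : MeasurableSet A), A ⊆ Y → ∀ v : Lp ℝ 2 (μ.restrict Y),
      inner ℝ (indicatorConstLp 2 hA (measure_ne_top (μ.restrict Y) A) (1 : ℝ)) v =
        ∫ x in A, v x ∂μ := by
    intro A hA hAY v
    rw [L2.inner_indicatorConstLp_one, Measure.restrict_restrict hA, inter_eq_left.2 hAY]
  have hinM : ∀ {A : Set X} (hA : MeasurableSet A), A ⊆ Y → ∀ l,
      inner ℝ (M l) (indicatorConstLp 2 hA (measure_ne_top (μ.restrict Y) A) (1 : ℝ)) =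
        ∫ x in A, m l x ∂μ - c l * μ.real A := by
    intro A hA hAY l
    have hfin : IsFiniteMeasure (μ.restrict A) :=
      ⟨by simpa using (measure_mono hAY).trans_lt hY.lt_top⟩
    rw [real_inner_comm, hin hA hAY]
    have h1 : (M l : X → ℝ) =ᵐ[μ.restrict A] fun x => m l x - c l :=
      ae_restrict_of_ae_restrict_of_subset hAY (MemLp.coeFn_toLp (hmem l))
    rw [integral_congr_ae h1, integral_sub (hmint l _) (integrable_const _)]
    simp [mul_comm]
  have hlim : ∀ v ∈ S, Tendsto (fun l => inner ℝ (M l) v) atTop (𝓝 0) := by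
    rintro v (rfl | ⟨g, A, hA, hAY, hgAY, rfl⟩)
    · have : ∀ l, inner ℝ (M l) (indicatorConstLp 2 MeasurableSet.univ
          (measure_ne_top (μ.restrict Y) univ) (1 : ℝ)) = 0 := by
        intro l
        rw [real_inner_comm, L2.inner_indicatorConstLp_one, Measure.restrict_univ,
          integral_congr_ae (MemLp.coeFn_toLp (hmem l)),
          integral_sub (hmint l _) (integrable_const _)]
        simp [hc, hYr, mul_div_cancel₀]
      exact tendsto_const_nhds.congr fun l => (this l).symm
    · have hAfin : μ A ≠ ∞ := ((measure_mono hAY).trans_lt hY.lt_top).ne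
      have hfin : IsFiniteMeasure (μ.restrict A) := ⟨by simpa using hAfin.lt_top⟩
      have hval : ∀ l, inner ℝ (M l) (indicatorConstLp 2 hA (measure_ne_top (μ.restrict Y) A)
          (1 : ℝ) - indicatorConstLp 2 (hA.const_vadd g) (measure_ne_top (μ.restrict Y) _) 1) =
          - ∫ x in A, (m l (g +ᵥ x) - m l x) ∂μ := by
        intro l
        have hshift : Integrable (fun x => m l (g +ᵥ x)) (μ.restrict A) :=
          Integrable.of_bound ((hm l).comp (measurable_const_vadd g)).aestronglyMeasurable C
            (ae_of_all _ fun x => hC l _)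
        rw [inner_sub_right, hinM hA hAY, hinM (hA.const_vadd g) hgAY, setIntegral_vadd,
          integral_sub hshift (hmint l _)]
        have : μ.real (g +ᵥ A) = μ.real A := by simp [Measure.real, measure_vadd]
        rw [this]
        ring
      simp_rw [hval]
      rw [Metric.tendsto_atTop]
      intro ε hε
      obtain ⟨N, hN⟩ := eventually_atTop.1 (hinv g (ε / (2 * (μ.real A + 1))) (by positivity))
      refine ⟨N, fun n hn => ?_⟩
      rw [dist_zero_right, norm_neg]
      calc ‖∫ x in A, (m n (g +ᵥ x) - m n x) ∂μ‖
          ≤ ε / (2 * (μ.real A + 1)) * μ.real A :=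
            norm_setIntegral_le_of_norm_le_const hAfin.lt_top fun x _ => hN n hn x
        _ ≤ ε / (2 * (μ.real A + 1)) * (μ.real A + 1) := by gcongr; linarith
        _ = ε / 2 := by
            have : μ.real A + 1 ≠ 0 := by positivity
            field_simp
        _ < ε := by linarith
  -- A vector orthogonal to `S` has mean zero. If it were positive on `P` and negative on `Q`, both
  -- non-null, ergodicity would carry a non-null part of `P` into `Q`, where the integral cannot be
  -- the same. So it has constant sign, and mean zero forces it to vanish.
  have htot : ∀ v : Lp ℝ 2 (μ.restrict Y), (∀ s ∈ S, inner ℝ s v = 0) → v = 0 := by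
    intro v hv
    have hvm : Measurable (v : X → ℝ) := (Lp.stronglyMeasurable v).measurable
    have hvint : Integrable (v : X → ℝ) (μ.restrict Y) :=
      (Lp.memLp v).integrable one_le_two
    have hmean : ∫ x in Y, v x ∂μ = 0 := by
      have := hv _ (Or.inl rfl)
      rwa [L2.inner_indicatorConstLp_one, Measure.restrict_univ] at this
    set P : Set X := Y ∩ {x | 0 < v x} with hP
    set Q : Set X := Y ∩ {x | v x < 0} with hQ
    have hPm : MeasurableSet P := hYm.inter (measurableSet_lt measurable_const hvm)
    have hQm : MeasurableSet Q := hYm.inter (measurableSet_lt hvm measurable_const)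
    have key : μ P = 0 ∨ μ Q = 0 := by
      by_contra! hne
      obtain ⟨g, hg⟩ := measure_vadd_inter_ne_zero_of_ergodic hPm hne.1 hne.2
      set A : Set X := P ∩ ((-g) +ᵥ Q) with hA
      have hAm : MeasurableSet A := hPm.inter (hQm.const_vadd _)
      have hgA : g +ᵥ A = (g +ᵥ P) ∩ Q := by
        rw [hA, Set.vadd_set_inter, vadd_neg_vadd]
      have hAP : A ⊆ P := inter_subset_left
      have hAY : A ⊆ Y := hAP.trans inter_subset_left
      have hgAQ : g +ᵥ A ⊆ Q := by rw [hgA]; exact inter_subset_right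
      have hgAY : g +ᵥ A ⊆ Y := hgAQ.trans inter_subset_left
      have h1 := hv _ (Or.inr ⟨g, A, hAm, hAY, hgAY, rfl⟩)
      rw [inner_sub_left, hin hAm hAY, hin (hAm.const_vadd g) hgAY] at h1
      have h2 : ∫ x in g +ᵥ A, v x ∂μ ≤ 0 :=
        setIntegral_nonpos (hAm.const_vadd g) fun x hx => (hgAQ hx).2.le
      have hA0 : μ A ≠ 0 := by rwa [← measure_vadd μ g A, hgA]
      have h3 : 0 < ∫ x in A, v x ∂μ := by
        rw [setIntegral_pos_iff_support_of_nonneg_ae]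
        · have : Function.support (v : X → ℝ) ∩ A = A :=
            inter_eq_right.2 fun x hx => (hAP hx).2.ne'
          rw [this]
          exact hA0.bot_lt
        · exact (ae_restrict_iff' hAm).2 (ae_of_all _ fun x hx => (hAP hx).2.le)
        · exact IntegrableOn.mono_set hvint hAY
      linarith
    rw [Lp.eq_zero_iff_ae_eq_zero]
    rcases key with h | h
    · have hle : ∀ᵐ x ∂μ.restrict Y, v x ≤ 0 := by
        rw [ae_restrict_iff' hYm]
        have : ∀ᵐ x ∂μ, x ∉ P := measure_eq_zero_iff_ae_notMem.1 h
        filter_upwards [this] with x hx hxY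
        by_contra! hlt
        exact hx ⟨hxY, hlt⟩
      have h2 : (fun x => -v x) =ᵐ[μ.restrict Y] 0 := by
        refine (integral_eq_zero_iff_of_nonneg_ae ?_ hvint.neg).1 ?_
        · filter_upwards [hle] with x hx
          simpa using hx
        · exact (integral_neg _).trans (by rw [hmean, neg_zero])
      filter_upwards [h2] with x hx
      simpa using hx
    · have hle : ∀ᵐ x ∂μ.restrict Y, 0 ≤ v x := by
        rw [ae_restrict_iff' hYm]
        have : ∀ᵐ x ∂μ, x ∉ Q := measure_eq_zero_iff_ae_notMem.1 h
        filter_upwards [this] with x hx hxY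
        by_contra! hlt
        exact hx ⟨hxY, hlt⟩
      exact (integral_eq_zero_iff_of_nonneg_ae hle hvint).1 hmean
  have hbound : ∀ l, ‖M l‖ ≤ (μ.restrict Y).real univ ^ ((2 : ℝ≥0∞).toReal)⁻¹ * (2 * C) := by
    intro l
    refine Lp.norm_le_of_ae_bound (by positivity) ?_
    filter_upwards [MemLp.coeFn_toLp (hmem l)] with x hx
    rw [hx]
    exact hb l x
  have hmain := tendsto_inner_zero_of_total hbound hlim htot (hf.toLp f)
  refine hmain.congr fun l => ?_
  rw [L2.inner_def]
  have hfint : Integrable f (μ.restrict Y) := hf.integrable one_le_two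
  have h1 : ∫ x in Y, inner ℝ (M l x) (hf.toLp f x) ∂μ = ∫ x in Y, (f x * m l x - f x * c l) ∂μ := by
    refine integral_congr_ae ?_
    filter_upwards [MemLp.coeFn_toLp (hmem l), MemLp.coeFn_toLp hf] with x hx hx'
    rw [hx, hx']
    simp
    ring
  rw [h1, integral_sub _ (hfint.mul_const _), integral_mul_const, h0]
  · simp
  · exact hfint.mul_bdd (hm l).aestronglyMeasurable (ae_of_all _ (hC l))

/-- A bounded, asymptotically invariant sequence of functions is asymptotically orthogonal to
every integrable function of mean zero. -/
theorem tendsto_integral_mul_zero [ErgodicVAdd ℤ X μ]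
    {m : ℕ → X → ℝ} (hm : ∀ l, Measurable (m l)) {C : ℝ}
    (hC : ∀ l x, |m l x| ≤ C)
    (hinv : ∀ g : ℤ, ∀ ε > 0, ∀ᶠ l in atTop, ∀ x, |m l (g +ᵥ x) - m l x| ≤ ε)
    {f : X → ℝ} (hf : Integrable f μ) (h0 : ∫ x, f x ∂μ = 0) :
    Tendsto (fun l => ∫ x, f x * m l x ∂μ) atTop (𝓝 0) := by
  rcases isEmpty_or_nonempty X with hX | ⟨⟨x₀⟩⟩
  · simp [μ.eq_zero_of_isEmpty]
  have hC0 : 0 ≤ C := (abs_nonneg _).trans (hC 0 x₀)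
  rw [Metric.tendsto_atTop]
  intro ε hε
  -- Two errors of size at most `C * δ < ε / 4` occur below, from replacing `f` by `g` and from
  -- recentring `g`; the square integrable case takes the remaining `ε / 2`.
  set δ : ℝ := ε / (4 * (C + 1)) with hδ
  have hδ0 : 0 < δ := by positivity
  obtain ⟨g, hg1, hg2⟩ := (memLp_one_iff_integrable.2 hf).exists_simpleFunc_eLpNorm_sub_lt
    ENNReal.one_ne_top (ENNReal.ofReal_pos.2 hδ0).ne'
  have hgint : Integrable g μ := memLp_one_iff_integrable.1 hg2
  have hfg : ∫ x, |f x - g x| ∂μ < δ := by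
    rw [eLpNorm_one_eq_lintegral_enorm, ← ofReal_integral_norm_eq_lintegral_enorm (hf.sub hgint),
      ENNReal.ofReal_lt_ofReal_iff hδ0] at hg1
    exact hg1
  set Y : Set X := Function.support g with hYdef
  have hYm : MeasurableSet Y := g.measurableSet_support
  have hY : μ Y < ∞ := g.measure_support_lt_top_of_integrable hgint
  have hfin : IsFiniteMeasure (μ.restrict Y) := ⟨by simpa using hY⟩
  have hgY : ∀ u : X → ℝ, ∫ x in Y, g x * u x ∂μ = ∫ x, g x * u x ∂μ := fun u =>
    setIntegral_eq_integral_of_forall_compl_eq_zero fun x hx => by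
      rw [Function.notMem_support.1 hx, zero_mul]
  have hgY1 : ∫ x in Y, g x ∂μ = ∫ x, g x ∂μ := by simpa using hgY fun _ => 1
  -- The simple function `g` has lost mean zero; subtracting `t` on its support restores it, at a
  -- cost controlled by `|t| μ(Y) ≤ δ`.
  set t : ℝ := (∫ x, g x ∂μ) / μ.real Y with ht
  have hmint : ∀ l, Integrable (m l) (μ.restrict Y) := fun l =>
    Integrable.of_bound (hm l).aestronglyMeasurable C (ae_of_all _ fun x => hC l x)
  have htY : t * μ.real Y = ∫ x, g x ∂μ := by
    rcases eq_or_ne (μ.real Y) 0 with h | h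
    · have : μ Y = 0 := (measureReal_eq_zero_iff hY.ne).1 h
      rw [← hgY1, Measure.restrict_eq_zero.2 this, h]
      simp
    · rw [ht, div_mul_cancel₀ _ h]
  have hmean : |∫ x, g x ∂μ| ≤ δ := by
    have h1 : ∫ x, g x ∂μ = - ∫ x, (f x - g x) ∂μ := by
      rw [integral_sub hf hgint, h0]; ring
    rw [h1, abs_neg]
    exact (abs_integral_le_integral_abs).trans hfg.le
  have hlim := tendsto_setIntegral_mul_zero (μ := μ) hYm hY.ne hm hC hinv
    (f := fun x => g x - t)
    ((g.memLp_of_isFiniteMeasure 2 (μ.restrict Y)).sub (memLp_const t)) (by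
      rw [integral_sub hgint.restrict (integrable_const _), hgY1]
      simp [← htY, mul_comm])
  obtain ⟨N, hN⟩ := Metric.tendsto_atTop.1 hlim (ε / 2) (by positivity)
  refine ⟨N, fun n hn => ?_⟩
  have h1 := hN n hn
  rw [dist_zero_right, Real.norm_eq_abs] at h1 ⊢
  have hgm : Integrable (fun x => g x * m n x) μ :=
    hgint.mul_bdd (hm n).aestronglyMeasurable (ae_of_all _ (hC n))
  have hfm : Integrable (fun x => f x * m n x) μ :=
    hf.mul_bdd (hm n).aestronglyMeasurable (ae_of_all _ (hC n))
  have h2 : ∫ x in Y, (g x - t) * m n x ∂μ = ∫ x, g x * m n x ∂μ - t * ∫ x in Y, m n x ∂μ := by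
    rw [← hgY, ← integral_const_mul, ← integral_sub hgm.restrict ((hmint n).const_mul t)]
    simp_rw [sub_mul]
  have h3 : |t * ∫ x in Y, m n x ∂μ| ≤ C * δ := by
    have : ‖∫ x in Y, m n x ∂μ‖ ≤ C * μ.real Y :=
      norm_setIntegral_le_of_norm_le_const hY fun x _ => hC n x
    rw [abs_mul]
    calc |t| * |∫ x in Y, m n x ∂μ| ≤ |t| * (C * μ.real Y) := by gcongr; exact this
      _ = C * |t * μ.real Y| := by
        rw [abs_mul, abs_of_nonneg (measureReal_nonneg (μ := μ) (s := Y))]; ring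
      _ ≤ C * δ := by rw [htY]; gcongr
  have h4 : |∫ x, f x * m n x ∂μ - ∫ x, g x * m n x ∂μ| ≤ C * δ := by
    rw [← integral_sub hfm hgm]
    calc |∫ x, (f x * m n x - g x * m n x) ∂μ| ≤ ∫ x, |f x - g x| * C ∂μ := by
          refine (abs_integral_le_integral_abs).trans ?_
          refine integral_mono (hfm.sub hgm).abs ((hf.sub hgint).abs.mul_const C) fun x => ?_
          simp only [← sub_mul, abs_mul]
          exact mul_le_mul_of_nonneg_left (hC n x) (abs_nonneg _)
      _ = C * ∫ x, |f x - g x| ∂μ := by rw [integral_mul_const, mul_comm]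
      _ ≤ C * δ := by gcongr
  have h5 : C * δ < ε / 4 := by
    rw [hδ]
    have : C * (ε / (4 * (C + 1))) = ε / 4 * (C / (C + 1)) := by field_simp
    rw [this]
    have : C / (C + 1) < 1 := by rw [div_lt_one (by linarith)]; linarith
    nlinarith
  rw [h2] at h1
  rw [abs_lt] at h1 ⊢
  rw [abs_le] at h3 h4
  constructor <;> linarith [h1.1, h1.2, h3.1, h3.2, h4.1, h4.2]

end Ergodic

/-! ### Counting visits of an orbit to a set. -/

section Visits

variable {X : Type*} [AddAction ℤ X]

/-- The number of `k ∈ K` with `x ∈ T_k E`. -/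
noncomputable def visits (K : Finset ℤ) (E : Set X) (x : X) : ℝ :=
  ∑ k ∈ K, (k +ᵥ E).indicator (fun _ => (1 : ℝ)) x

open Classical in
theorem visits_eq_card (K : Finset ℤ) (E : Set X) (x : X) :
    visits K E x = ((K.filter fun k => x ∈ k +ᵥ E).card : ℝ) := by
  simp [visits, Set.indicator_apply, Finset.sum_boole]

theorem visits_nonneg (K : Finset ℤ) (E : Set X) (x : X) : 0 ≤ visits K E x := by
  rw [visits_eq_card]; positivity

theorem visits_mono (K : Finset ℤ) {E E' : Set X} (h : E ⊆ E') (x : X) :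
    visits K E x ≤ visits K E' x :=
  Finset.sum_le_sum fun _ _ => Set.indicator_le_indicator_of_subset (Set.vadd_set_mono h)
    (fun _ => zero_le_one) x

/-- Moving the point by `g` amounts to moving the window by `-g`. The times leaving the old window
lie in `[a - g, a)` or `[b, b - g)`, one of which is empty while the other has `|g|` elements. -/
theorem visits_Ico_vadd_le (a b g : ℤ) (E : Set X) (x : X) :
    visits (Finset.Ico a b) E (g +ᵥ x) ≤ visits (Finset.Ico a b) E x + |(g : ℝ)| := by
  classical
  have hg : |(g : ℝ)| = (g.natAbs : ℝ) := by rw [Nat.cast_natAbs, Int.cast_abs]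
  rw [visits_eq_card, visits_eq_card, hg]
  norm_cast
  have hsub : ((Finset.Ico a b).filter fun k => g +ᵥ x ∈ k +ᵥ E).map
      (addRightEmbedding (-g)) ⊆ ((Finset.Ico a b).filter fun k => x ∈ k +ᵥ E) ∪
        (Finset.Ico (a - g) a ∪ Finset.Ico b (b - g)) := by
    intro k hk
    obtain ⟨j, hj, rfl⟩ := Finset.mem_map.1 hk
    rw [Finset.mem_filter, Finset.mem_Ico, Set.mem_vadd_set_iff_neg_vadd_mem] at hj
    simp only [addRightEmbedding_apply, Finset.mem_union, Finset.mem_filter, Finset.mem_Ico,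
      Set.mem_vadd_set_iff_neg_vadd_mem]
    have h2 : -(j + -g) +ᵥ x ∈ E := by
      have := hj.2
      rwa [vadd_vadd, show -j + g = -(j + -g) by ring] at this
    by_cases h3 : a ≤ j + -g ∧ j + -g < b
    · exact Or.inl ⟨h3, h2⟩
    · right; omega
  have := (Finset.card_map _).symm.le.trans (Finset.card_le_card hsub)
  refine this.trans ((Finset.card_union_le _ _).trans ?_)
  refine Nat.add_le_add_left ?_ _
  refine (Finset.card_union_le _ _).trans ?_
  simp only [Int.card_Ico]
  omega

theorem abs_visits_Ico_vadd_sub_le (a b g : ℤ) (E : Set X) (x : X) :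
    |visits (Finset.Ico a b) E (g +ᵥ x) - visits (Finset.Ico a b) E x| ≤ |(g : ℝ)| := by
  have h1 := visits_Ico_vadd_le a b g E x
  have h2 := visits_Ico_vadd_le a b (-g) E (g +ᵥ x)
  rw [neg_vadd_vadd, Int.cast_neg, abs_neg] at h2
  rw [abs_le]
  constructor <;> linarith

variable [MeasurableSpace X] [MeasurableConstVAdd ℤ X] {μ : Measure X}

theorem measurable_visits (K : Finset ℤ) {E : Set X} (hE : MeasurableSet E) :
    Measurable (visits K E) :=
  Finset.measurable_sum _ fun k _ => measurable_const.indicator (hE.const_vadd k)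

theorem integral_mul_visits (K : Finset ℤ) {E : Set X} (hE : MeasurableSet E) {f : X → ℝ}
    (hf : Integrable f μ) :
    ∫ x, f x * visits K E x ∂μ = ∑ k ∈ K, ∫ x in k +ᵥ E, f x ∂μ := by
  have h1 : ∀ x, f x * visits K E x = ∑ k ∈ K, (k +ᵥ E).indicator f x := by
    intro x
    rw [visits, Finset.mul_sum]
    refine Finset.sum_congr rfl fun k _ => ?_
    by_cases hx : x ∈ k +ᵥ E <;> simp [hx]
  simp_rw [h1]
  rw [integral_finsetSum _ fun k _ => hf.indicator (hE.const_vadd k)]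
  exact Finset.sum_congr rfl fun k _ => integral_indicator (hE.const_vadd k)

end Visits

/-! ### Towers: upper and lower bounds for visits. -/

section Tower

variable {X : Type*} [AddAction ℤ X]

/-- The levels `T_k B`, `0 ≤ k < h`, are pairwise disjoint. -/
def IsTower (B : Set X) (h : ℕ) : Prop :=
  ∀ i < h, ∀ j < h, i ≠ j → Disjoint ((i : ℤ) +ᵥ B) ((j : ℤ) +ᵥ B)

/-- The union of the levels with index in `I` of the tower with base `B`. -/
def levels (B : Set X) (I : Finset ℕ) : Set X := ⋃ i ∈ I, (i : ℤ) +ᵥ B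

theorem mem_levels {B : Set X} {I : Finset ℕ} {x : X} :
    x ∈ levels B I ↔ ∃ i ∈ I, x ∈ (i : ℤ) +ᵥ B := by simp [levels]

/-- In a time window shorter than the height of a tower, every level is visited at most once. -/
theorem IsTower.visits_le {B : Set X} {h : ℕ} (hB : IsTower B h) {I : Finset ℕ}
    {Y : Set X} (hY : Y ⊆ levels B I) {K : Finset ℤ}
    (hK : ∀ k ∈ K, ∀ k' ∈ K, k - k' < h) (x : X) : visits K Y x ≤ I.card := by
  classical
  rw [visits_eq_card]
  norm_cast
  have hex : ∀ k ∈ K.filter fun k => x ∈ k +ᵥ Y, ∃ i ∈ I, -(k + i) +ᵥ x ∈ B := by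
    intro k hk
    have h1 := Set.mem_vadd_set_iff_neg_vadd_mem.1 (Finset.mem_filter.1 hk).2
    obtain ⟨i, hi, h2⟩ := mem_levels.1 (hY h1)
    refine ⟨i, hi, ?_⟩
    rw [Set.mem_vadd_set_iff_neg_vadd_mem, vadd_vadd] at h2
    rwa [show -(k + (i : ℤ)) = -(i : ℤ) + -k by ring]
  choose! φ hφI hφB using hex
  -- Two times `k < k'` with the same level index would put one point in both the base and its
  -- translate by `k' - k`, which is less than the height. Thus the level index is an injective
  -- function of the visit time.
  have hle : ∀ k ∈ K.filter (fun k => x ∈ k +ᵥ Y), ∀ k' ∈ K.filter (fun k => x ∈ k +ᵥ Y),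
      φ k = φ k' → ¬ k < k' := by
    intro k hk k' hk' heq hlt
    have h1 := hφB k hk
    have h2 := hφB k' hk'
    rw [heq] at h1
    have hd := hK k' (Finset.mem_filter.1 hk').1 k (Finset.mem_filter.1 hk).1
    obtain ⟨d, hd'⟩ := Int.eq_ofNat_of_zero_le (sub_nonneg.2 hlt.le)
    have hne : d ≠ 0 := by rintro rfl; simp at hd'; omega
    have hdisj := hB 0 (by omega) d (by omega) hne.symm
    have h3 : -(k + (φ k' : ℤ)) +ᵥ x ∈ ((0 : ℕ) : ℤ) +ᵥ B := by simpa using h1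
    refine Set.disjoint_left.1 hdisj h3 ?_
    rw [Set.mem_vadd_set_iff_neg_vadd_mem, vadd_vadd, ← hd']
    rwa [show -(k' - k) + -(k + (φ k' : ℤ)) = -(k' + (φ k' : ℤ)) by ring]
  refine Finset.card_le_card_of_injOn φ hφI fun k hk k' hk' heq => ?_
  have h1 := hle k hk k' hk' heq
  have h2 := hle k' hk' k hk heq.symm
  omega

theorem IsTower.visits_Ico_le {B : Set X} {h : ℕ} (hB : IsTower B h) {I : Finset ℕ}
    {Y : Set X} (hY : Y ⊆ levels B I) (x : X) :
    visits (Finset.Ico 0 (h : ℤ)) Y x ≤ I.card :=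
  hB.visits_le hY (fun k hk k' hk' => by rw [Finset.mem_Ico] at hk hk'; omega) x

theorem IsTower.visits_Ico_neg_le {B : Set X} {h : ℕ} (hB : IsTower B h) {I : Finset ℕ}
    {Y : Set X} (hY : Y ⊆ levels B I) (x : X) :
    visits (Finset.Ico (1 - (h : ℤ)) 1) Y x ≤ I.card :=
  hB.visits_le hY (fun k hk k' hk' => by rw [Finset.mem_Ico] at hk hk'; omega) x

theorem measureReal_vadd [MeasurableSpace X] {μ : Measure X} [VAddInvariantMeasure ℤ X μ]
    (g : ℤ) (A : Set X) : μ.real (g +ᵥ A) = μ.real A := by simp [Measure.real, measure_vadd]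

variable [MeasurableSpace X] [MeasurableConstVAdd ℤ X] {μ : Measure X}

theorem measurableSet_levels {B : Set X} (hB : MeasurableSet B) (I : Finset ℕ) :
    MeasurableSet (levels B I) :=
  Finset.measurableSet_biUnion _ fun i _ => hB.const_vadd (i : ℤ)

theorem measure_levels [VAddInvariantMeasure ℤ X μ] {B : Set X} (hBm : MeasurableSet B) {h : ℕ}
    (hB : IsTower B h) {I : Finset ℕ} (hI : I ⊆ Finset.range h) :
    μ (levels B I) = I.card * μ B := by
  rw [levels, measure_biUnion_finset (f := fun i : ℕ => (i : ℤ) +ᵥ B) ?_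
    fun i _ => hBm.const_vadd (i : ℤ)]
  · simp [measure_vadd]
  · intro i hi j hj hij
    exact hB i (Finset.mem_range.1 (hI hi)) j (Finset.mem_range.1 (hI hj)) hij

/-- Cauchy–Schwarz against the constant function, read off from the integral of `(m f - s)² ≥ 0`,
where `m` is the total mass and `s` the integral of `f`. -/
theorem sq_integral_le {α : Type*} [MeasurableSpace α] {ν : Measure α} [IsFiniteMeasure ν]
    {f : α → ℝ} (hf : Integrable f ν) (hf2 : Integrable (fun x => f x ^ 2) ν) :
    (∫ x, f x ∂ν) ^ 2 ≤ ν.real univ * ∫ x, f x ^ 2 ∂ν := by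
  set m := ν.real univ
  set s := ∫ x, f x ∂ν
  have h : 0 ≤ ∫ x, (m * f x - s) ^ 2 ∂ν := integral_nonneg fun x => sq_nonneg _
  have h2 : ∫ x, (m * f x - s) ^ 2 ∂ν = m * (m * ∫ x, f x ^ 2 ∂ν - s ^ 2) := by
    have : ∀ x, (m * f x - s) ^ 2 = m ^ 2 * f x ^ 2 - 2 * m * s * f x + s ^ 2 := fun x => by ring
    have hi1 : Integrable (fun x => m ^ 2 * f x ^ 2) ν := hf2.const_mul _
    have hi2 : Integrable (fun x => 2 * m * s * f x) ν := hf.const_mul _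
    have hi3 : Integrable (fun x => m ^ 2 * f x ^ 2 - 2 * m * s * f x) ν := hi1.sub hi2
    simp_rw [this]
    rw [integral_add hi3 (integrable_const _), integral_sub hi1 hi2, integral_const_mul, integral_const_mul,
      integral_const, smul_eq_mul]
    change m ^ 2 * _ - 2 * m * s * s + m * s ^ 2 = _
    ring
  rw [h2] at h
  rcases (measureReal_nonneg (μ := ν) (s := univ)).eq_or_lt with h0 | h0
  · have : ν = 0 := Measure.measure_univ_eq_zero.1
      ((measureReal_eq_zero_iff (measure_ne_top _ _)).1 h0.symm)
    simp [s, this]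
  · have := nonneg_of_mul_nonneg_right h h0
    linarith

/-- If `Y` is covered by `N` levels of a tower of height `h`, then the number of visits to `Y`
during the time `h`, averaged over `Y`, is at least of order `N`. -/
theorem card_mul_sq_le_returnSum [VAddInvariantMeasure ℤ X μ] {B : Set X} (hBm : MeasurableSet B)
    (hBfin : μ B ≠ ∞) {h : ℕ} (hB : IsTower B h) {I : Finset ℕ} (hI : I ⊆ Finset.range h)
    {Y : Set X} (hYm : MeasurableSet Y) (hY : Y ⊆ levels B I) :
    I.card * μ.real Y ^ 2 ≤ 2 * μ.real (levels B I) * returnSum μ Y Y h := by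
  have hfinB : IsFiniteMeasure (μ.restrict B) := ⟨by simpa using hBfin.lt_top⟩
  have hlev : μ.real (levels B I) = I.card * μ.real B := by
    simp [Measure.real, measure_levels hBm hB hI]
  have hYfin : μ Y ≠ ∞ := by
    refine ((measure_mono hY).trans_lt ?_).ne
    rw [measure_levels hBm hB hI]
    exact ENNReal.mul_lt_top (by simp) hBfin.lt_top
  set u : ℕ → X → ℝ := fun i => (-(i : ℤ) +ᵥ Y).indicator fun _ => (1 : ℝ) with hu
  have hum : ∀ i : ℕ, MeasurableSet (-(i : ℤ) +ᵥ Y) := fun i => hYm.const_vadd _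
  have huu : ∀ i j x, u i x * u j x =
      ((-(i : ℤ) +ᵥ Y) ∩ (-(j : ℤ) +ᵥ Y)).indicator (fun _ => (1 : ℝ)) x := by
    intro i j x
    by_cases h1 : x ∈ -(i : ℤ) +ᵥ Y <;> by_cases h2 : x ∈ -(j : ℤ) +ᵥ Y <;> simp [hu, h1, h2]
  have hint : ∀ i, Integrable (u i) (μ.restrict B) := fun i =>
    (integrable_const _).indicator (hum i)
  have hint2 : ∀ i j, Integrable (fun x => u i x * u j x) (μ.restrict B) := fun i j => by
    simp_rw [huu]
    exact (integrable_const _).indicator ((hum i).inter (hum j))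
  -- On the base, `n x` counts the indices `i ∈ I` with `T_i x ∈ Y`. Its integral over `B` is
  -- `μ(Y)`, and its second moment is a double sum of correlations that the return sum will
  -- dominate.
  set n : X → ℝ := fun x => ∑ i ∈ I, u i x with hn
  have hsq : ∀ x, n x ^ 2 = ∑ i ∈ I, ∑ j ∈ I, u i x * u j x := fun x => by
    rw [sq, hn, Finset.sum_mul_sum]
  have hnint : Integrable n (μ.restrict B) := integrable_finsetSum _ fun i _ => hint i
  have hn2int : Integrable (fun x => n x ^ 2) (μ.restrict B) := by
    simp_rw [hsq]
    exact integrable_finsetSum _ fun i _ => integrable_finsetSum _ fun j _ => hint2 i j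
  have hone : ∀ {s : Set X}, MeasurableSet s →
      ∫ x in B, s.indicator (fun _ => (1 : ℝ)) x ∂μ = μ.real (B ∩ s) := by
    intro s hs
    rw [integral_indicator hs, Measure.restrict_restrict hs, inter_comm]
    simp
  have hfirst : ∫ x in B, n x ∂μ = μ.real Y := by
    rw [hn, integral_finsetSum _ fun i _ => hint i]
    have h1 : ∀ i ∈ I, ∫ x in B, u i x ∂μ = μ.real (((i : ℤ) +ᵥ B) ∩ Y) := by
      intro i _
      rw [hu, hone (hum i), ← measureReal_vadd (i : ℤ), Set.vadd_set_inter, vadd_neg_vadd]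
    rw [Finset.sum_congr rfl h1, ← measureReal_biUnion_finset]
    · congr 1
      rw [← iUnion₂_inter]
      exact inter_eq_right.2 hY
    · intro i hi j hj hij
      exact (hB i (Finset.mem_range.1 (hI hi)) j (Finset.mem_range.1 (hI hj)) hij).mono
        inter_subset_left inter_subset_left
    · exact fun i _ => (hBm.const_vadd (i : ℤ)).inter hYm
  set G : ℕ → ℕ → ℝ := fun i j => ∫ x in B, u i x * u j x ∂μ with hG
  have hsecond : ∫ x in B, n x ^ 2 ∂μ = ∑ i ∈ I, ∑ j ∈ I, G i j := by
    simp_rw [hsq]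
    rw [integral_finsetSum _ fun i _ => integrable_finsetSum _ fun j _ => hint2 i j]
    exact Finset.sum_congr rfl fun i _ => integral_finsetSum _ fun j _ => hint2 i j
  have hG0 : ∀ i j, 0 ≤ G i j := fun i j => integral_nonneg fun x => by
    simp_rw [huu]
    exact Set.indicator_nonneg (fun _ _ => zero_le_one) x
  have hGval : ∀ i j, j ≤ i → G i j =
      μ.real (((i : ℤ) +ᵥ B) ∩ (Y ∩ (((i - j : ℕ) : ℤ) +ᵥ Y))) := by
    intro i j hji
    rw [hG]
    simp_rw [huu]
    rw [hone ((hum i).inter (hum j)), ← measureReal_vadd (i : ℤ), Set.vadd_set_inter,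
      Set.vadd_set_inter, vadd_neg_vadd, vadd_vadd, Nat.cast_sub hji, sub_eq_add_neg]
  -- For fixed `i`, the differences `i - j` are distinct and lie in `[0, h)`, so the row is part of
  -- a sum over all return times. Summing over the disjoint levels `T_i B` then recovers at most the
  -- return sum.
  have hrow : ∀ i ∈ I, ∑ j ∈ I with j ≤ i, G i j ≤
      ∑ k ∈ Finset.range h, μ.real (((i : ℤ) +ᵥ B) ∩ (Y ∩ ((k : ℤ) +ᵥ Y))) := by
    intro i hi
    have hinj : Set.InjOn (fun j => i - j) (I.filter (· ≤ i) : Set ℕ) := by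
      intro a ha b hb hab
      have h1 := (Finset.mem_filter.1 ha).2
      have h2 := (Finset.mem_filter.1 hb).2
      simp only at hab
      omega
    rw [Finset.sum_congr rfl fun j hj => hGval i j (Finset.mem_filter.1 hj).2,
      ← Finset.sum_image (f := fun k : ℕ => μ.real (((i : ℤ) +ᵥ B) ∩ (Y ∩ ((k : ℤ) +ᵥ Y)))) hinj]
    refine Finset.sum_le_sum_of_subset_of_nonneg ?_ fun _ _ _ => measureReal_nonneg
    intro k hk
    obtain ⟨j, -, rfl⟩ := Finset.mem_image.1 hk
    have := Finset.mem_range.1 (hI hi)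
    exact Finset.mem_range.2 (by omega)
  have hlower : ∑ i ∈ I, ∑ j ∈ I with j ≤ i, G i j ≤ returnSum μ Y Y h := by
    refine (Finset.sum_le_sum hrow).trans ?_
    rw [Finset.sum_comm, returnSum]
    refine Finset.sum_le_sum fun k _ => ?_
    rw [← measureReal_biUnion_finset]
    · exact measureReal_mono (iUnion₂_subset fun i _ => inter_subset_right)
        ((measure_mono inter_subset_left).trans_lt hYfin.lt_top).ne
    · intro i hi j hj hij
      exact (hB i (Finset.mem_range.1 (hI hi)) j (Finset.mem_range.1 (hI hj)) hij).mono
        inter_subset_left inter_subset_left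
    · exact fun i _ => (hBm.const_vadd (i : ℤ)).inter (hYm.inter (hYm.const_vadd _))
  have hsym : ∀ i j, G i j = G j i := fun i j => by simp only [hG, mul_comm]
  -- By symmetry the triangle `j ≤ i` accounts for half of the square; counting the diagonal twice
  -- is harmless because the terms are nonnegative.
  have hsplit : ∑ i ∈ I, ∑ j ∈ I, G i j ≤ 2 * ∑ i ∈ I, ∑ j ∈ I with j ≤ i, G i j := by
    have h1 : ∑ i ∈ I, ∑ j ∈ I, (if j ≤ i then G i j else 0) =
        ∑ i ∈ I, ∑ j ∈ I, (if i ≤ j then G i j else 0) := by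
      rw [Finset.sum_comm]
      simp_rw [hsym]
    simp_rw [Finset.sum_filter]
    rw [two_mul]
    nth_rewrite 2 [h1]
    simp_rw [← Finset.sum_add_distrib]
    refine Finset.sum_le_sum fun i _ => Finset.sum_le_sum fun j _ => ?_
    have := hG0 i j
    rcases le_total j i with hij | hij
    · rw [if_pos hij]; split_ifs <;> linarith
    · rw [if_pos hij]; split_ifs <;> linarith
  have hCS := sq_integral_le hnint hn2int
  rw [hfirst, hsecond, measureReal_restrict_apply_univ] at hCS
  have hmu : 0 ≤ μ.real B := measureReal_nonneg
  calc (I.card : ℝ) * μ.real Y ^ 2 ≤ I.card * (μ.real B * ∑ i ∈ I, ∑ j ∈ I, G i j) := by gcongr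
    _ ≤ I.card * (μ.real B * (2 * returnSum μ Y Y h)) := by
        gcongr
        linarith
    _ = 2 * μ.real (levels B I) * returnSum μ Y Y h := by rw [hlev]; ring

end Tower

/-! ### Sums over windows of integers. -/

section Windows

theorem setIntegral_indicator_one {X : Type*} [MeasurableSpace X] {μ : Measure X}
    {A D : Set X} (hA : MeasurableSet A) :
    ∫ x in D, A.indicator (fun _ => (1 : ℝ)) x ∂μ = μ.real (A ∩ D) := by
  rw [integral_indicator hA, Measure.restrict_restrict hA]
  simp

variable {X : Type*} [MeasurableSpace X] [AddAction ℤ X] {μ : Measure X}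

/-- Applying `T_{-k}` exchanges the roles of the two sets and reflects the window; for half-open
intervals the reflection of `[a, b)` is `[1 - b, 1 - a)`. -/
theorem sum_measureReal_inter_neg [VAddInvariantMeasure ℤ X μ] (a b : ℤ) (A B : Set X) :
    ∑ k ∈ Finset.Ico (1 - b) (1 - a), μ.real (A ∩ (k +ᵥ B)) =
      ∑ k ∈ Finset.Ico a b, μ.real (B ∩ (k +ᵥ A)) := by
  refine Finset.sum_nbij' (fun k => -k) (fun k => -k) ?_ ?_ ?_ ?_ ?_
  · intro k hk; simp only [Finset.mem_Ico] at hk ⊢; omega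
  · intro k hk; simp only [Finset.mem_Ico] at hk ⊢; omega
  · intro k _; simp
  · intro k _; simp
  · intro k _
    rw [← measureReal_vadd (-k), Set.vadd_set_inter, neg_vadd_vadd, inter_comm]

theorem preimage_vadd_ae_eq [VAddInvariantMeasure ℤ X μ] {S : X → X}
    (hS : ∀ k : ℤ, ∀ᵐ x ∂μ, S (k +ᵥ x) = k +ᵥ S x) (k : ℤ) (A : Set X) :
    S ⁻¹' (k +ᵥ A) =ᵐ[μ] k +ᵥ (S ⁻¹' A) := by
  filter_upwards [hS (-k)] with x hx
  refine propext ?_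
  change x ∈ S ⁻¹' (k +ᵥ A) ↔ x ∈ k +ᵥ (S ⁻¹' A)
  rw [Set.mem_vadd_set_iff_neg_vadd_mem, mem_preimage, mem_preimage,
    Set.mem_vadd_set_iff_neg_vadd_mem, hx]

theorem returnSum_eq_sum_Ico (A B : Set X) (n : ℕ) :
    returnSum μ A B n = ∑ k ∈ Finset.Ico (0 : ℤ) n, μ.real (A ∩ (k +ᵥ B)) := by
  rw [returnSum]
  refine Finset.sum_nbij (fun k : ℕ => (k : ℤ)) ?_ ?_ ?_ ?_
  · intro k hk; simpa using hk
  · intro a _ b _ h; simpa using h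
  · intro k hk
    have := Finset.mem_Ico.1 (Finset.mem_coe.1 hk)
    exact ⟨k.toNat, by simp; omega, by simp; omega⟩
  · intro k _; rfl

end Windows

/-! ### Limits of normalised window sums. -/

section Averages

variable {X : Type*} [MeasurableSpace X] [AddAction ℤ X] [MeasurableConstVAdd ℤ X]
  {μ : Measure X}

/-- The normalised visit functions are bounded by `C`, as `E ⊆ Y`, and are asymptotically invariant
because a translation by `g` alters the count by at most `|g|` while `s l → ∞`. -/
theorem tendsto_window_sum_zero [ErgodicVAdd ℤ X μ] {Y : Set X} {a b : ℕ → ℤ} {s : ℕ → ℝ} {C : ℝ}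
    (hs0 : ∀ l, 0 < s l) (hs : Tendsto s atTop atTop)
    (hv : ∀ l x, visits (Finset.Ico (a l) (b l)) Y x ≤ C * s l)
    {E : Set X} (hE : MeasurableSet E) (hEY : E ⊆ Y) {f : X → ℝ} (hf : Integrable f μ)
    (h0 : ∫ x, f x ∂μ = 0) :
    Tendsto (fun l => (s l)⁻¹ * ∑ k ∈ Finset.Ico (a l) (b l), ∫ x in k +ᵥ E, f x ∂μ)
      atTop (𝓝 0) := by
  have key := tendsto_integral_mul_zero (μ := μ)
    (m := fun l x => (s l)⁻¹ * visits (Finset.Ico (a l) (b l)) E x) (C := C)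
    (fun l => (measurable_visits _ hE).const_mul _) ?_ ?_ hf h0
  · refine key.congr fun l => ?_
    rw [← integral_mul_visits _ hE hf, ← integral_const_mul]
    congr 1
    ext x
    ring
  · intro l x
    rw [abs_mul, abs_of_nonneg (visits_nonneg _ _ _), abs_of_pos (inv_pos.2 (hs0 l)),
      inv_mul_le_iff₀ (hs0 l), mul_comm]
    exact (visits_mono _ hEY x).trans (hv l x)
  · intro g ε hε
    filter_upwards [hs.eventually_ge_atTop (|(g : ℝ)| / ε)] with l hl x
    rw [← mul_sub, abs_mul, abs_of_pos (inv_pos.2 (hs0 l)), inv_mul_le_iff₀ (hs0 l)]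
    exact (abs_visits_Ico_vadd_sub_le _ _ _ _ _).trans ((div_le_iff₀ hε).1 hl)

/-- The mean-zero case applies to the difference of `f` and the multiple of the indicator of `Y`
with the same integral. -/
theorem tendsto_window_sum_sub [ErgodicVAdd ℤ X μ] {Y : Set X} (hYm : MeasurableSet Y)
    (hY0 : μ Y ≠ 0) (hYfin : μ Y ≠ ∞) {a b : ℕ → ℤ} {s : ℕ → ℝ} {C : ℝ}
    (hs0 : ∀ l, 0 < s l) (hs : Tendsto s atTop atTop)
    (hv : ∀ l x, visits (Finset.Ico (a l) (b l)) Y x ≤ C * s l)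
    {E : Set X} (hE : MeasurableSet E) (hEY : E ⊆ Y) {f : X → ℝ} (hf : Integrable f μ) :
    Tendsto (fun l => (s l)⁻¹ * ∑ k ∈ Finset.Ico (a l) (b l), ∫ x in k +ᵥ E, f x ∂μ -
      (∫ x, f x ∂μ) / μ.real Y *
        ((s l)⁻¹ * ∑ k ∈ Finset.Ico (a l) (b l), μ.real (Y ∩ (k +ᵥ E)))) atTop (𝓝 0) := by
  have hYr : μ.real Y ≠ 0 := by simp [Measure.real, ENNReal.toReal_eq_zero_iff, hY0, hYfin]
  set t : ℝ := (∫ x, f x ∂μ) / μ.real Y with ht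
  have hi : Integrable (fun x => t * Y.indicator (fun _ => (1 : ℝ)) x) μ :=
    ((integrable_indicator_iff hYm).2 (integrableOn_const hYfin)).const_mul t
  have key := tendsto_window_sum_zero hs0 hs hv hE hEY
    (f := fun x => f x - t * Y.indicator (fun _ => (1 : ℝ)) x) (hf.sub hi) (by
      rw [integral_sub hf hi, integral_const_mul, integral_indicator hYm]
      simp [ht, hYr])
  refine key.congr fun l => ?_
  have : ∀ k : ℤ, ∫ x in k +ᵥ E, (f x - t * Y.indicator (fun _ => (1 : ℝ)) x) ∂μ =
      ∫ x in k +ᵥ E, f x ∂μ - t * μ.real (Y ∩ (k +ᵥ E)) := by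
    intro k
    rw [integral_sub hf.restrict hi.restrict, integral_const_mul, setIntegral_indicator_one hYm]
  simp_rw [this, Finset.sum_sub_distrib, ← Finset.mul_sum]
  ring

/-- Comparing `f` with the indicator of `Y` leaves the sums of `μ(Y ∩ T_k E)` to be evaluated.
Reflecting the window turns them into sums of `μ(E ∩ T_k Y)`, and the same comparison, now between
the indicators of `E` and `Y`, reduces these to `s l`. This is why visits must be bounded in the
reflected window as well. -/
theorem tendsto_window_sum [ErgodicVAdd ℤ X μ] {Y : Set X} (hYm : MeasurableSet Y)
    (hY0 : μ Y ≠ 0) (hYfin : μ Y ≠ ∞) {a b : ℕ → ℤ} {s : ℕ → ℝ} {C : ℝ}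
    (hs0 : ∀ l, 0 < s l) (hs : Tendsto s atTop atTop)
    (hv : ∀ l x, visits (Finset.Ico (a l) (b l)) Y x ≤ C * s l)
    (hv' : ∀ l x, visits (Finset.Ico (1 - b l) (1 - a l)) Y x ≤ C * s l)
    (hsum : ∀ l, ∑ k ∈ Finset.Ico (a l) (b l), μ.real (Y ∩ (k +ᵥ Y)) = s l)
    {E : Set X} (hE : MeasurableSet E) (hEY : E ⊆ Y) {f : X → ℝ} (hf : Integrable f μ) :
    Tendsto (fun l => (s l)⁻¹ * ∑ k ∈ Finset.Ico (a l) (b l), ∫ x in k +ᵥ E, f x ∂μ) atTop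
      (𝓝 (μ.real E / μ.real Y ^ 2 * ∫ x, f x ∂μ)) := by
  have hEfin : μ E ≠ ∞ := ((measure_mono hEY).trans_lt hYfin.lt_top).ne
  have hEint : Integrable (E.indicator fun _ => (1 : ℝ)) μ :=
    (integrable_indicator_iff hE).2 (integrableOn_const hEfin)
  have hEtot : ∫ x, E.indicator (fun _ => (1 : ℝ)) x ∂μ = μ.real E := by
    rw [integral_indicator hE]; simp
  have h1 := tendsto_window_sum_sub hYm hY0 hYfin hs0 hs hv' hYm subset_rfl hEint
  have h2 : Tendsto (fun l => (s l)⁻¹ * ∑ k ∈ Finset.Ico (a l) (b l), μ.real (Y ∩ (k +ᵥ E)))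
      atTop (𝓝 (μ.real E / μ.real Y)) := by
    have h3 := h1.add_const (μ.real E / μ.real Y)
    rw [zero_add] at h3
    refine h3.congr fun l => ?_
    simp_rw [setIntegral_indicator_one hE, hEtot, sum_measureReal_inter_neg, hsum,
      inv_mul_cancel₀ (hs0 l).ne']
    ring
  have h4 := (tendsto_window_sum_sub hYm hY0 hYfin hs0 hs hv hE hEY hf).add
    (h2.const_mul ((∫ x, f x ∂μ) / μ.real Y))
  refine (h4.congr fun l => ?_).trans_eq ?_
  · ring
  · congr 1
    ring

end Averages

/-! ### Nonsingular maps commuting with the action. -/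

section NonSquashable

variable {X : Type*} [MeasurableSpace X] [AddAction ℤ X] [MeasurableConstVAdd ℤ X]
  {μ : Measure X}

/-- If a nonsingular transformation commuting with an ergodic action preserves the measure of the
subsets of one set of positive measure, then it preserves the measure. -/
theorem measurePreserving_of_commute_of_subset [ErgodicVAdd ℤ X μ] {Y : Set X}
    (hYm : MeasurableSet Y) (hY0 : μ Y ≠ 0) {S : X → X}
    (hSq : Measure.QuasiMeasurePreserving S μ μ)
    (hS : ∀ k : ℤ, ∀ᵐ x ∂μ, S (k +ᵥ x) = k +ᵥ S x)
    (hY : ∀ A, MeasurableSet A → A ⊆ Y → μ (S ⁻¹' A) = μ A) : MeasurePreserving S μ μ := by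
  refine ⟨hSq.measurable, ?_⟩
  have htrans : ∀ (g : ℤ) A, MeasurableSet A → A ⊆ g +ᵥ Y → μ (S ⁻¹' A) = μ A := by
    intro g A hA hAY
    have h1 : -g +ᵥ A ⊆ Y := by
      have := Set.vadd_set_mono (a := -g) hAY
      rwa [neg_vadd_vadd] at this
    rw [← measure_vadd μ (-g) (S ⁻¹' A), ← measure_congr (preimage_vadd_ae_eq hS (-g) A),
      hY _ (hA.const_vadd _) h1, measure_vadd]
  set U : Set X := ⋃ g : ℤ, g +ᵥ Y with hU
  have hUm : MeasurableSet U := MeasurableSet.iUnion fun g => hYm.const_vadd g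
  have hU0 : μ Uᶜ = 0 := by
    by_contra hne
    obtain ⟨g, hg⟩ := measure_vadd_inter_ne_zero_of_ergodic hYm hY0 hne
    refine hg ?_
    rw [(disjoint_compl_right.mono_left (subset_iUnion (fun g : ℤ => g +ᵥ Y) g)).inter_eq]
    exact measure_empty
  -- The translates of `Y` cover all but a null set, indexed by `none`. The image measure and `μ`
  -- agree on each piece: by commutation on the translates, by nonsingularity on the null set.
  let W : Option ℤ → Set X := fun o => o.elim Uᶜ fun g => g +ᵥ Y
  have hW : ⋃ o, W o = univ := by
    rw [iUnion_option]
    exact compl_union_self U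
  refine (Measure.ext_iff_of_iUnion_eq_univ hW).2 fun o => ?_
  have hWm : MeasurableSet (W o) := by
    cases o with
    | none => exact hUm.compl
    | some g => exact hYm.const_vadd g
  ext A hA
  rw [Measure.restrict_apply hA, Measure.restrict_apply hA,
    Measure.map_apply hSq.measurable (hA.inter hWm)]
  cases o with
  | none =>
    have h1 : μ (A ∩ W none) = 0 := measure_mono_null inter_subset_right hU0
    rw [h1, hSq.preimage_null h1]
  | some g => exact htrans g _ (hA.inter hWm) inter_subset_right

/-- Commutation gives `ν(T_k A) = μ(Y ∩ T_k S⁻¹A)` for the image `ν` of `μ` restricted to `Y`. Since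
`ν ≪ μ` has total mass `μ(Y)`, its density is an admissible test function, and the limit obtained
does not involve `S`. -/
theorem isNonSquashable_of_window [SigmaFinite μ] [ErgodicVAdd ℤ X μ] {Y : Set X}
    (hYm : MeasurableSet Y) (hY0 : μ Y ≠ 0) (hYfin : μ Y ≠ ∞) {a b : ℕ → ℤ} {s : ℕ → ℝ} {C : ℝ}
    (hs0 : ∀ l, 0 < s l) (hs : Tendsto s atTop atTop)
    (hv : ∀ l x, visits (Finset.Ico (a l) (b l)) Y x ≤ C * s l)
    (hv' : ∀ l x, visits (Finset.Ico (1 - b l) (1 - a l)) Y x ≤ C * s l)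
    (hsum : ∀ l, ∑ k ∈ Finset.Ico (a l) (b l), μ.real (Y ∩ (k +ᵥ Y)) = s l) :
    IsNonSquashable μ := by
  intro S hSq hS
  have hYr : 0 < μ.real Y := ENNReal.toReal_pos hY0 hYfin
  have : IsFiniteMeasure (μ.restrict Y) := ⟨by simpa using hYfin.lt_top⟩
  refine measurePreserving_of_commute_of_subset hYm hY0 hSq hS fun A hA hAY => ?_
  have hAfin : μ A ≠ ∞ := ((measure_mono hAY).trans_lt hYfin.lt_top).ne
  set Z := S ⁻¹' A with hZ
  have hZm : MeasurableSet Z := hSq.measurable hA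
  set ν : Measure X := (μ.restrict Y).map S with hν
  have hνμ : ν ≪ μ :=
    (Measure.restrict_le_self.absolutelyContinuous.map hSq.measurable).trans
      hSq.absolutelyContinuous
  have hνval : ∀ k : ℤ, ν.real (k +ᵥ A) = μ.real (Y ∩ (k +ᵥ Z)) := by
    intro k
    rw [hν, map_measureReal_apply hSq.measurable (hA.const_vadd k),
      measureReal_restrict_apply (hSq.measurable (hA.const_vadd k)), inter_comm]
    exact measureReal_congr ((ae_eq_refl Y).inter (preimage_vadd_ae_eq hS k A))
  have hνuniv : ν.real univ = μ.real Y := by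
    rw [hν, map_measureReal_apply hSq.measurable MeasurableSet.univ, preimage_univ,
      measureReal_restrict_apply_univ]
  have hlim1 : Tendsto (fun l => (s l)⁻¹ * ∑ k ∈ Finset.Ico (a l) (b l), μ.real (Y ∩ (k +ᵥ Z)))
      atTop (𝓝 (μ.real A / μ.real Y)) := by
    have h1 := tendsto_window_sum hYm hY0 hYfin hs0 hs hv hv' hsum hA hAY
      (f := fun x => (ν.rnDeriv μ x).toReal) Measure.integrable_toReal_rnDeriv
    simp_rw [Measure.setIntegral_toReal_rnDeriv hνμ, hνval] at h1
    rw [Measure.integral_toReal_rnDeriv hνμ, hνuniv] at h1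
    refine h1.trans_eq ?_
    congr 1
    field_simp
  have hlim2 : ∀ Z', MeasurableSet Z' → μ Z' ≠ ∞ →
      Tendsto (fun l => (s l)⁻¹ * ∑ k ∈ Finset.Ico (a l) (b l), μ.real (Y ∩ (k +ᵥ Z')))
        atTop (𝓝 (μ.real Z' / μ.real Y)) := by
    intro Z' hZ'm hZ'fin
    have h1 := tendsto_window_sum (f := Z'.indicator fun _ => (1 : ℝ))
      (a := fun l => 1 - b l) (b := fun l => 1 - a l) hYm hY0 hYfin hs0 hs hv'
      (by simpa using hv) (fun l => by rw [sum_measureReal_inter_neg, hsum]) hYm subset_rfl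
      ((integrable_indicator_iff hZ'm).2 (integrableOn_const hZ'fin))
    simp_rw [setIntegral_indicator_one hZ'm, sum_measureReal_inter_neg] at h1
    refine h1.trans_eq ?_
    rw [integral_indicator hZ'm]
    simp only [integral_const, measureReal_restrict_apply_univ, smul_eq_mul, mul_one]
    congr 1
    field_simp
  -- The direct limit needs finite measure, which is not yet known for `S⁻¹A`. Its subsets of finite
  -- measure are bounded first, and `σ`-finiteness then gives finiteness of the whole.
  have hle : ∀ Z', MeasurableSet Z' → μ Z' ≠ ∞ → Z' ⊆ Z → μ Z' ≤ μ A := by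
    intro Z' hZ'm hZ'fin hZ'Z
    have h1 : μ.real Z' / μ.real Y ≤ μ.real A / μ.real Y := by
      refine le_of_tendsto_of_tendsto' (hlim2 Z' hZ'm hZ'fin) hlim1 fun l => ?_
      refine mul_le_mul_of_nonneg_left (Finset.sum_le_sum fun k _ => ?_) (inv_pos.2 (hs0 l)).le
      exact measureReal_mono (inter_subset_inter_right _ (Set.vadd_set_mono hZ'Z))
        ((measure_mono inter_subset_left).trans_lt hYfin.lt_top).ne
    rw [div_le_div_iff_of_pos_right hYr] at h1
    exact (ENNReal.toReal_le_toReal hZ'fin hAfin).1 h1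
  have hZle : μ Z ≤ μ A := by
    by_contra! hlt
    obtain ⟨Z', hZ'm, hZ'Z, h1, h2⟩ := Measure.exists_subset_measure_lt_top hZm hlt
    exact absurd (hle Z' hZ'm h2.ne hZ'Z) (not_le.2 h1)
  have hZfin : μ Z ≠ ∞ := (hZle.trans_lt hAfin.lt_top).ne
  have heq := tendsto_nhds_unique (hlim2 Z hZm hZfin) hlim1
  rw [div_left_inj' hYr.ne'] at heq
  exact (ENNReal.toReal_eq_toReal_iff' hZfin hAfin).1 heq

end NonSquashable

/-! ### Consequences of a tower cover. -/

section TowerConsequences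

variable {X : Type*} [MeasurableSpace X] [AddAction ℤ X] [MeasurableConstVAdd ℤ X]
  {μ : Measure X}

/-- The set `Y` is covered by many levels of towers of heights `h l`, of bounded total measure. -/
structure TowerCover (μ : Measure X) (Y : Set X) (h : ℕ → ℕ) : Prop where
  measurableSet : MeasurableSet Y
  ne_zero : μ Y ≠ 0
  ne_top : μ Y ≠ ∞
  exists_cover : ∃ (B : ℕ → Set X) (I : ℕ → Finset ℕ) (M : ℝ),
    (∀ l, MeasurableSet (B l) ∧ μ (B l) ≠ ∞ ∧ IsTower (B l) (h l) ∧ I l ⊆ Finset.range (h l) ∧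
      Y ⊆ levels (B l) (I l) ∧ μ.real (levels (B l) (I l)) ≤ M) ∧
    Tendsto (fun l => (I l).card) atTop atTop

variable {Y : Set X} {h : ℕ → ℕ}

/-- The number of covering levels bounds the visits pointwise and is itself at most `2 M / μ(Y)²`
times the return sum. As it tends to infinity, so does the return sum. -/
theorem TowerCover.exists_visits_le [VAddInvariantMeasure ℤ X μ] (H : TowerCover μ Y h) :
    (∀ l, 0 < returnSum μ Y Y (h l)) ∧ Tendsto (fun l => returnSum μ Y Y (h l)) atTop atTop ∧
    ∃ C : ℝ, (∀ l x, visits (Finset.Ico 0 (h l : ℤ)) Y x ≤ C * returnSum μ Y Y (h l)) ∧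
      ∀ l x, visits (Finset.Ico (1 - (h l : ℤ)) (1 - 0)) Y x ≤ C * returnSum μ Y Y (h l) := by
  obtain ⟨hYm, hY0, hYfin, B, I, M, hB, hI⟩ := H
  have hYr : 0 < μ.real Y := ENNReal.toReal_pos hY0 hYfin
  have hMpos : 0 < M := by
    obtain ⟨h1, h2, h3, h4, h5, h6⟩ := hB 0
    refine (hYr.trans_le (measureReal_mono h5 ?_)).trans_le h6
    rw [measure_levels h1 h3 h4]
    exact ENNReal.mul_ne_top (by simp) h2
  have hret : ∀ l, 0 ≤ returnSum μ Y Y (h l) := fun l =>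
    Finset.sum_nonneg fun k _ => measureReal_nonneg
  have hcard : ∀ l, ((I l).card : ℝ) ≤ 2 * M / μ.real Y ^ 2 * returnSum μ Y Y (h l) := by
    intro l
    obtain ⟨h1, h2, h3, h4, h5, h6⟩ := hB l
    have h7 := card_mul_sq_le_returnSum h1 h2 h3 h4 hYm h5
    rw [div_mul_eq_mul_div, le_div_iff₀ (by positivity)]
    refine h7.trans ?_
    have := hret l
    gcongr
  have hpos : ∀ l, 0 < returnSum μ Y Y (h l) := by
    intro l
    obtain ⟨h1, h2, h3, h4, h5, h6⟩ := hB l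
    have hne : 0 < (I l).card := by
      rw [Finset.card_pos]
      obtain ⟨x, hx⟩ := nonempty_of_measure_ne_zero hY0
      obtain ⟨i, hi, -⟩ := mem_levels.1 (h5 hx)
      exact ⟨i, hi⟩
    have h7 : (0 : ℝ) < (I l).card := by exact_mod_cast hne
    exact pos_of_mul_pos_right (h7.trans_le (hcard l)) (by positivity)
  refine ⟨hpos, ?_, 2 * M / μ.real Y ^ 2, fun l x => ?_, fun l x => ?_⟩
  · have h1 : Tendsto (fun l => ((I l).card : ℝ)) atTop atTop :=
      tendsto_natCast_atTop_atTop.comp hI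
    have h2 : 0 < 2 * M / μ.real Y ^ 2 := by positivity
    refine (tendsto_const_mul_atTop_of_pos h2).1 (tendsto_atTop_mono hcard h1)
  · obtain ⟨h1, h2, h3, h4, h5, h6⟩ := hB l
    exact (h3.visits_Ico_le h5 x).trans (hcard l)
  · obtain ⟨h1, h2, h3, h4, h5, h6⟩ := hB l
    rw [sub_zero]
    exact (h3.visits_Ico_neg_le h5 x).trans (hcard l)

theorem TowerCover.tendsto_returnSum [ErgodicVAdd ℤ X μ] (H : TowerCover μ Y h) {A B : Set X}
    (hA : MeasurableSet A) (hB : MeasurableSet B) (hAY : A ⊆ Y) (hBY : B ⊆ Y) :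
    Tendsto (fun n => (1 / (returnSum μ Y Y (h n) / μ.real Y ^ 2)) * returnSum μ A B (h n))
      atTop (𝓝 (μ.real A * μ.real B)) := by
  obtain ⟨h1, h2, C, h3, h4⟩ := H.exists_visits_le
  have hYr : 0 < μ.real Y := ENNReal.toReal_pos H.ne_zero H.ne_top
  have hAfin : μ A ≠ ∞ := ((measure_mono hAY).trans_lt H.ne_top.lt_top).ne
  have key := tendsto_window_sum (a := fun _ => 0) (b := fun l => (h l : ℤ))
    (f := A.indicator fun _ => (1 : ℝ)) H.measurableSet H.ne_zero H.ne_top h1 h2 h3 h4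
    (fun l => (returnSum_eq_sum_Ico _ _ _).symm) hB hBY
    ((integrable_indicator_iff hA).2 (integrableOn_const hAfin))
  simp_rw [setIntegral_indicator_one hA, ← returnSum_eq_sum_Ico] at key
  rw [integral_indicator hA] at key
  simp only [integral_const, measureReal_restrict_apply_univ, smul_eq_mul, mul_one] at key
  refine ((key.const_mul (μ.real Y ^ 2)).congr fun l => ?_).trans_eq ?_
  · rw [one_div_div]
    ring
  · congr 1
    field_simp

theorem TowerCover.isNonSquashable [SigmaFinite μ] [ErgodicVAdd ℤ X μ] (H : TowerCover μ Y h) :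
    IsNonSquashable μ := by
  obtain ⟨h1, h2, C, h3, h4⟩ := H.exists_visits_le
  exact isNonSquashable_of_window (a := fun _ => 0) (b := fun l => (h l : ℤ)) H.measurableSet
    H.ne_zero H.ne_top h1 h2 h3 h4 fun l => (returnSum_eq_sum_Ico _ _ _).symm

end TowerConsequences

/-! ### Rank one: ergodicity, conservativity and a tower cover. -/

section RankOne

variable {X : Type*} [MeasurableSpace X] [AddAction ℤ X] {μ : Measure X}

/-- A sequence of towers whose levels approximate all sets of finite measure. -/
structure RankOneTowers (μ : Measure X) (B : ℕ → Set X) (h : ℕ → ℕ) : Prop where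
  measurableSet : ∀ n, MeasurableSet (B n)
  ne_top : ∀ n, μ (B n) ≠ ∞
  isTower : ∀ n, IsTower (B n) (h n)
  approx : ∀ A, MeasurableSet A → μ A < ∞ → ∀ ε > 0, ∀ᶠ n in atTop,
    ∃ I ⊆ Finset.range (h n), μ (symmDiff A (levels (B n) I)) < ε

theorem IsRankOne.exists_towers (H : IsRankOne μ) : ∃ B h, RankOneTowers μ B h := by
  obtain ⟨B, h, h1, h2, h3⟩ := H
  refine ⟨B, h, fun n => (h1 n).1, fun n => (h1 n).2.ne, h2, fun A hA hAfin ε hε => ?_⟩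
  filter_upwards [(h3 A hA hAfin).eventually (gt_mem_nhds hε)] with n hn
  simp only [iInf_lt_iff, Finset.mem_powerset] at hn
  obtain ⟨F, hF, hlt⟩ := hn
  exact ⟨F, hF, hlt⟩

theorem measure_le_add_symmDiff {α : Type*} [MeasurableSpace α] {ν : Measure α} (A U : Set α) :
    ν A ≤ ν (A ∩ U) + ν (symmDiff A U) := by
  refine (measure_mono fun x hx => ?_).trans (measure_union_le _ _)
  by_cases h : x ∈ U
  · exact Or.inl ⟨hx, h⟩
  · exact Or.inr (Or.inl ⟨hx, h⟩)

variable {B : ℕ → Set X} {h : ℕ → ℕ}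

/-- Approximating a small set `A` with error below `μ(A)` requires at least one level, and that
level lies in `A` together with the error, so its measure is less than `2 μ(A)`. -/
theorem RankOneTowers.tendsto_base [VAddInvariantMeasure ℤ X μ] (H : RankOneTowers μ B h)
    (hsmall : ∀ δ > 0, ∃ A, MeasurableSet A ∧ 0 < μ A ∧ μ A < δ) :
    Tendsto (fun n => μ (B n)) atTop (𝓝 0) := by
  rw [ENNReal.tendsto_nhds_zero]
  intro δ hδ
  -- The minimum with `⊤` guarantees that `A` has finite measure even when `δ` is infinite.
  obtain ⟨A, hA, hA0, hAδ⟩ := hsmall (min (δ / 2) ⊤)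
    (lt_min (ENNReal.div_pos hδ.ne' (by simp)) (by simp))
  filter_upwards [H.approx A hA (hAδ.trans_le (min_le_right _ _)) _ hA0] with n ⟨I, hI, hlt⟩
  have hne : I.Nonempty := by
    rw [Finset.nonempty_iff_ne_empty]
    rintro rfl
    have : symmDiff A ∅ = A := symmDiff_bot A
    simp [levels, this] at hlt
  obtain ⟨i, hi⟩ := hne
  calc μ (B n) = μ ((i : ℤ) +ᵥ B n) := (measure_vadd _ _ _).symm
    _ ≤ μ (A ∪ symmDiff A (levels (B n) I)) := by
        refine measure_mono fun x hx => ?_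
        by_cases hxA : x ∈ A
        · exact Or.inl hxA
        · exact Or.inr (Or.inr ⟨mem_levels.2 ⟨i, hi, hx⟩, hxA⟩)
    _ ≤ μ A + μ (symmDiff A (levels (B n) I)) := measure_union_le _ _
    _ ≤ δ / 2 + δ / 2 := add_le_add (hAδ.le.trans (min_le_left _ _))
        (hlt.le.trans (hAδ.le.trans (min_le_left _ _)))
    _ = δ := ENNReal.add_halves δ

variable [MeasurableConstVAdd ℤ X]

/-- Most of the base of a late tower lies in a given invariant set of positive measure. -/
theorem RankOneTowers.eventually_lt_of_invariant [SigmaFinite μ] [VAddInvariantMeasure ℤ X μ]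
    (H : RankOneTowers μ B h) {s : Set X} (hs : MeasurableSet s) (hs0 : μ s ≠ 0)
    (hinv : ∀ g : ℤ, (g +ᵥ ·) ⁻¹' s =ᵐ[μ] s) :
    ∀ᶠ n in atTop, 2 * μ.real (B n \ s) < μ.real (B n) := by
  obtain ⟨A, hA, hAs, hA0, hAfin⟩ := Measure.exists_subset_measure_lt_top hs hs0.bot_lt
  have hAr : 0 < μ.real A := ENNReal.toReal_pos hA0.ne' hAfin.ne
  -- With error below `μ(A) / 4`, the levels have measure above `3 μ(A) / 4` and less than `μ(A) /
  -- 4` of it outside `s`, which is a fraction below one half.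
  filter_upwards [H.approx A hA hAfin (ENNReal.ofReal (μ.real A / 4))
    (ENNReal.ofReal_pos.2 (by positivity))] with n ⟨I, hI, hlt⟩
  have hBm := H.measurableSet n
  have hUfin : μ (levels (B n) I) ≠ ∞ := by
    rw [measure_levels hBm (H.isTower n) hI]
    exact ENNReal.mul_ne_top (by simp) (H.ne_top n)
  have hsd : μ (symmDiff A (levels (B n) I)) ≠ ∞ := (hlt.trans ENNReal.ofReal_lt_top).ne
  have hlt' : μ.real (symmDiff A (levels (B n) I)) < μ.real A / 4 := by
    rw [← ENNReal.toReal_ofReal (show 0 ≤ μ.real A / 4 by positivity)]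
    exact (ENNReal.toReal_lt_toReal hsd ENNReal.ofReal_ne_top).2 hlt
  have hU : μ.real (levels (B n) I) = I.card * μ.real (B n) := by
    simp [Measure.real, measure_levels hBm (H.isTower n) hI]
  -- By invariance of `s`, every level has the same part outside `s` as the base, so the fraction
  -- for the union is that of the base.
  have hUs : μ (levels (B n) I \ s) = I.card * μ (B n \ s) := by
    have hlev : ∀ i ∈ I, μ (((i : ℤ) +ᵥ B n) \ s) = μ (B n \ s) := by
      intro i _
      rw [← measure_vadd μ (i : ℤ) (B n \ s), Set.vadd_set_sdiff]
      refine measure_congr ((ae_eq_refl _).diff ?_)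
      have := hinv (-(i : ℤ))
      rw [Set.preimage_vadd, neg_neg] at this
      exact this.symm
    have heq : levels (B n) I \ s = ⋃ i ∈ I, ((i : ℤ) +ᵥ B n) \ s := by
      simp only [levels, iUnion_sdiff]
    rw [heq, measure_biUnion_finset (f := fun i : ℕ => ((i : ℤ) +ᵥ B n) \ s) ?_
      fun i _ => (hBm.const_vadd (i : ℤ)).diff hs, Finset.sum_congr rfl hlev]
    · simp
    · intro i hi j hj hij
      exact (H.isTower n i (Finset.mem_range.1 (hI hi)) j (Finset.mem_range.1 (hI hj)) hij).mono
        sdiff_subset sdiff_subset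
  have hUsr : μ.real (levels (B n) I \ s) = I.card * μ.real (B n \ s) := by
    simp [Measure.real, hUs]
  have h1 : μ.real (levels (B n) I \ s) < μ.real A / 4 := by
    refine (measureReal_mono (fun x hx => ?_) hsd).trans_lt hlt'
    exact Or.inr ⟨hx.1, fun hxA => hx.2 (hAs hxA)⟩
  have h2 : μ.real A ≤ μ.real (levels (B n) I) + μ.real (symmDiff A (levels (B n) I)) := by
    refine (measureReal_mono (fun x hx => ?_) (measure_union_ne_top hUfin hsd)).trans
      (measureReal_union_le _ _)
    by_cases hxU : x ∈ levels (B n) I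
    · exact Or.inl hxU
    · exact Or.inr (Or.inl ⟨hx, hxU⟩)
  rw [hU] at h2
  rw [hUsr] at h1
  by_contra! hcon
  have h3 : (I.card : ℝ) * μ.real (B n) ≤ I.card * (2 * μ.real (B n \ s)) := by gcongr
  linarith

/-- If an invariant set and its complement both had positive measure, more than half of the base of
a late tower would lie in each. -/
theorem RankOneTowers.ergodicVAdd [SigmaFinite μ] [VAddInvariantMeasure ℤ X μ]
    (H : RankOneTowers μ B h) : ErgodicVAdd ℤ X μ := by
  refine ⟨fun {s} hs hinv => ?_⟩
  by_contra hcon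
  rw [eventuallyConst_set', not_or] at hcon
  have hs0 : μ s ≠ 0 := fun h0 => hcon.1 (ae_eq_empty.2 h0)
  have hsc0 : μ sᶜ ≠ 0 := fun h0 => hcon.2 (ae_eq_univ.2 h0)
  have h1 := H.eventually_lt_of_invariant hs hs0 hinv
  have h2 := H.eventually_lt_of_invariant hs.compl hsc0 fun g => (hinv g).compl
  obtain ⟨n, hn1, hn2⟩ := (h1.and h2).exists
  rw [sdiff_compl] at hn2
  have := measureReal_inter_add_sdiff (μ := μ) (s := B n) hs (H.ne_top n)
  linarith

/-- Suppose no point of `s` ever returns to `s`. Because bases become small, a level cuts a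
finite-measure part `s₁` of `s` into a piece `P` and a non-null remainder. Ergodicity moves some
point of `P` into the remainder by some `g`, necessarily nonzero, and this is a return under `g` or
`-g`. -/
theorem RankOneTowers.conservative [SigmaFinite μ] [ErgodicVAdd ℤ X μ]
    (H : RankOneTowers μ B h) (hB : Tendsto (fun n => μ (B n)) atTop (𝓝 0)) :
    Conservative (fun x : X => (1 : ℤ) +ᵥ x) μ := by
  refine ⟨(measurePreserving_vadd (1 : ℤ) μ).quasiMeasurePreserving, fun s hs hs0 => ?_⟩
  by_contra! hcon
  have hiter : ∀ (m : ℕ) (x : X), (fun x : X => (1 : ℤ) +ᵥ x)^[m] x = (m : ℤ) +ᵥ x := by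
    intro m
    induction m with
    | zero => intro x; simp
    | succ m ih =>
      intro x
      rw [Function.iterate_succ_apply', ih, vadd_vadd]
      congr 1
      push_cast
      ring
  have hwander : ∀ x ∈ s, ∀ g : ℤ, 0 < g → g +ᵥ x ∉ s := by
    intro x hx g hg hgx
    refine hcon x hx g.toNat (by omega) ?_
    rw [hiter, Int.toNat_of_nonneg hg.le]
    exact hgx
  obtain ⟨s₁, hs₁, hs₁s, hs₁0, hs₁fin⟩ := Measure.exists_subset_measure_lt_top hs hs0.bot_lt
  obtain ⟨n, hn, I, hI, hlt⟩ := ((hB.eventually (gt_mem_nhds hs₁0)).and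
    (H.approx s₁ hs₁ hs₁fin _ hs₁0)).exists
  have hinter : μ (s₁ ∩ levels (B n) I) ≠ 0 := by
    intro h0
    have := measure_le_add_symmDiff (ν := μ) s₁ (levels (B n) I)
    rw [h0, zero_add] at this
    exact absurd this (not_le.2 hlt)
  obtain ⟨i, hi⟩ : ∃ i : ℕ, μ (s₁ ∩ ((i : ℤ) +ᵥ B n)) ≠ 0 := by
    by_contra! hall
    refine hinter (measure_mono_null (t := ⋃ i : ℕ, s₁ ∩ ((i : ℤ) +ᵥ B n)) ?_
      (measure_iUnion_null hall))
    rintro x ⟨hx, hxU⟩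
    obtain ⟨i, -, hxi⟩ := mem_levels.1 hxU
    exact mem_iUnion.2 ⟨i, hx, hxi⟩
  set P := s₁ ∩ ((i : ℤ) +ᵥ B n) with hP
  have hPm : MeasurableSet P := hs₁.inter ((H.measurableSet n).const_vadd _)
  have hPlt : μ P < μ s₁ := by
    refine (measure_mono inter_subset_right).trans_lt ?_
    rwa [measure_vadd]
  have hM : μ (s₁ \ P) ≠ 0 := by
    intro h0
    refine absurd (measure_le_inter_add_sdiff μ s₁ P) (not_le.2 ?_)
    rw [h0, add_zero]
    exact (measure_mono inter_subset_right).trans_lt hPlt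
  obtain ⟨g, hg⟩ := measure_vadd_inter_ne_zero_of_ergodic hPm hi hM
  obtain ⟨x, hx1, hx2⟩ := nonempty_of_measure_ne_zero hg
  rw [Set.mem_vadd_set_iff_neg_vadd_mem] at hx1
  rcases lt_trichotomy g 0 with h1 | h1 | h1
  · exact hwander x (hs₁s hx2.1) (-g) (by omega) (hs₁s hx1.1)
  · rw [h1, neg_zero, zero_vadd] at hx1
    exact hx2.2 hx1
  · refine hwander (-g +ᵥ x) (hs₁s hx1.1) g h1 ?_
    rw [vadd_neg_vadd]
    exact hs₁s hx2.1

/-- Some set of finite positive measure is covered, along a subsequence, by many levels of the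
towers, of bounded total measure. -/
theorem RankOneTowers.exists_towerCover [SigmaFinite μ] [VAddInvariantMeasure ℤ X μ]
    (H : RankOneTowers μ B h) (hB : Tendsto (fun n => μ (B n)) atTop (𝓝 0)) (hμ : μ ≠ 0) :
    ∃ (Y : Set X) (k : ℕ → ℕ), StrictMono k ∧ TowerCover μ Y k := by
  obtain ⟨A, hA, -, hA0, hAfin⟩ := Measure.exists_subset_measure_lt_top (μ := μ)
    MeasurableSet.univ (r := 0) (Measure.measure_univ_pos.2 hμ)
  -- The errors sum to less than `μ(A)`, so intersecting `A` with all the approximations leaves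
  -- positive measure.
  obtain ⟨ε, hε0, hε⟩ := ENNReal.exists_pos_sum_of_countable hA0.ne' ℕ
  -- Any good approximation far enough along uses more than `m` levels, since `m` levels have total
  -- measure tending to zero.
  have hex : ∀ j m : ℕ, ∃ p : ℕ × Finset ℕ, p.2 ⊆ Finset.range (h p.1) ∧ m < p.2.card ∧
      μ (symmDiff A (levels (B p.1) p.2)) < ε j := by
    intro j m
    have h1 : Tendsto (fun n => (m : ℝ≥0∞) * μ (B n)) atTop (𝓝 0) := by
      simpa using ENNReal.Tendsto.const_mul hB (Or.inr (ENNReal.natCast_ne_top m))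
    have hpos : 0 < min (μ A / 2) (ε j) := lt_min (ENNReal.div_pos hA0.ne' (by simp))
      (by exact_mod_cast hε0 j)
    obtain ⟨n, hn, I, hI, hlt⟩ := ((h1.eventually (gt_mem_nhds
      (ENNReal.div_pos hA0.ne' (by simp : (2 : ℝ≥0∞) ≠ ∞)))).and
      (H.approx A hA hAfin _ hpos)).exists
    refine ⟨(n, I), hI, ?_, hlt.trans_le (min_le_right _ _)⟩
    by_contra! hle
    have h2 : μ (levels (B n) I) ≤ m * μ (B n) := by
      rw [measure_levels (H.measurableSet n) (H.isTower n) hI]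
      gcongr
    have h3 := measure_le_add_symmDiff (ν := μ) A (levels (B n) I)
    refine absurd h3 (not_le.2 ?_)
    calc μ (A ∩ levels (B n) I) + μ (symmDiff A (levels (B n) I))
        < μ A / 2 + μ A / 2 := ENNReal.add_lt_add
          (((measure_mono inter_subset_right).trans h2).trans_lt hn)
          (hlt.trans_le (min_le_left _ _))
      _ = μ A := ENNReal.add_halves _
  choose φ hφ1 hφ2 hφ3 using hex
  -- Each stage uses more levels than the previous height plus the stage number. A tower has at
  -- least as many levels as are used, so the heights increase strictly and the numbers of levels
  -- tend to infinity.
  let q : ℕ → ℕ × Finset ℕ := fun j =>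
    Nat.rec (φ 0 0) (fun i p => φ (i + 1) (h p.1 + i)) j
  have hq : ∀ j, q (j + 1) = φ (j + 1) (h (q j).1 + j) := fun j => rfl
  have hq1 : ∀ j, (q j).2 ⊆ Finset.range (h (q j).1) := by
    intro j; cases j with
    | zero => exact hφ1 0 0
    | succ j => exact hφ1 _ _
  have hq3 : ∀ j, μ (symmDiff A (levels (B (q j).1) (q j).2)) < ε j := by
    intro j; cases j with
    | zero => exact hφ3 0 0
    | succ j => exact hφ3 _ _
  have hq2 : ∀ j, h (q j).1 + j < (q (j + 1)).2.card := fun j => hφ2 _ _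
  have hcard : ∀ j, (q j).2.card ≤ h (q j).1 := fun j => by
    simpa using Finset.card_le_card (hq1 j)
  set Y : Set X := A ∩ ⋂ j, levels (B (q j).1) (q j).2 with hY
  have hYcov : ∀ j, Y ⊆ levels (B (q j).1) (q j).2 := fun j =>
    inter_subset_right.trans (iInter_subset _ j)
  have hlevm : ∀ j, MeasurableSet (levels (B (q j).1) (q j).2) := fun j =>
    measurableSet_levels (H.measurableSet _) _
  have hεtop : ∀ j, (ε j : ℝ≥0∞) ≤ μ A := fun j => (ENNReal.le_tsum j).trans hε.le
  refine ⟨Y, fun j => h (q j).1, strictMono_nat_of_lt_succ fun j => ?_,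
    hA.inter (MeasurableSet.iInter hlevm), ?_,
    ((measure_mono inter_subset_left).trans_lt hAfin).ne,
    fun j => B (q j).1, fun j => (q j).2, (μ A + μ A).toReal, fun j => ?_, ?_⟩
  · have := hq2 j
    have := hcard (j + 1)
    omega
  · intro h0
    have h1 : μ A ≤ μ Y + ∑' j, (ε j : ℝ≥0∞) := by
      calc μ A ≤ μ (Y ∪ ⋃ j, symmDiff A (levels (B (q j).1) (q j).2)) := by
            refine measure_mono fun x hx => ?_
            by_cases hxY : x ∈ Y
            · exact Or.inl hxY
            · right
              have : ∃ j, x ∉ levels (B (q j).1) (q j).2 := by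
                by_contra! hall
                exact hxY ⟨hx, mem_iInter.2 hall⟩
              obtain ⟨j, hj⟩ := this
              exact mem_iUnion.2 ⟨j, Or.inl ⟨hx, hj⟩⟩
        _ ≤ μ Y + ∑' j, μ (symmDiff A (levels (B (q j).1) (q j).2)) :=
            (measure_union_le _ _).trans (by gcongr; exact measure_iUnion_le _)
        _ ≤ μ Y + ∑' j, (ε j : ℝ≥0∞) := by
            gcongr with j
            exact (hq3 j).le
    rw [h0, zero_add] at h1
    exact absurd h1 (not_le.2 hε)
  · refine ⟨H.measurableSet _, H.ne_top _, H.isTower _, hq1 j, hYcov j, ?_⟩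
    refine ENNReal.toReal_mono (by finiteness) ?_
    calc μ (levels (B (q j).1) (q j).2)
        ≤ μ (A ∪ symmDiff A (levels (B (q j).1) (q j).2)) := by
          refine measure_mono fun x hx => ?_
          by_cases hxA : x ∈ A
          · exact Or.inl hxA
          · exact Or.inr (Or.inr ⟨hx, hxA⟩)
      _ ≤ μ A + μ A := (measure_union_le _ _).trans (by
          exact add_le_add_right ((hq3 j).le.trans (hεtop j)) _)
  · refine tendsto_atTop_mono' _ ?_ (tendsto_sub_atTop_nat 1)
    filter_upwards [eventually_ge_atTop 1] with j hj
    obtain ⟨i, rfl⟩ := Nat.exists_eq_add_of_le' hj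
    have := hq2 i
    omega

theorem RankOneTowers.isWeaklyRationallyErgodicAlong [SigmaFinite μ] [VAddInvariantMeasure ℤ X μ]
    (H : RankOneTowers μ B h) (hB : Tendsto (fun n => μ (B n)) atTop (𝓝 0))
    {Y : Set X} {k : ℕ → ℕ} (hY : TowerCover μ Y k) : IsWeaklyRationallyErgodicAlong μ k := by
  have := H.ergodicVAdd
  exact ⟨inferInstance, this, H.conservative hB, Y, hY.measurableSet,
    hY.ne_zero.bot_lt, hY.ne_top.lt_top, fun A B hA hB hAY hBY =>
    hY.tendsto_returnSum hA hB hAY hBY⟩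

end RankOne

/-! ### Small sets in a non-atomic standard space. -/

section Nonatomic

/-- Embed a piece of finite positive measure into the line and take a point all of whose
neighbourhoods are charged. The point itself is null, so outer regularity gives a neighbourhood of
small, still positive, measure. -/
theorem exists_measure_pos_lt {X : Type*} [MeasurableSpace X] [StandardBorelSpace X]
    {μ : Measure X} [SigmaFinite μ] [NullSingletonClass μ] (hμ : μ ≠ 0) {δ : ℝ≥0∞} (hδ : 0 < δ) :
    ∃ A, MeasurableSet A ∧ 0 < μ A ∧ μ A < δ := by
  obtain ⟨s, hs, -, hs0, hsfin⟩ := Measure.exists_subset_measure_lt_top (μ := μ)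
    MeasurableSet.univ (r := 0) (Measure.measure_univ_pos.2 hμ)
  have : IsFiniteMeasure (μ.restrict s) := ⟨by simpa using hsfin⟩
  have he := MeasureTheory.measurableEmbedding_embeddingReal X
  set ν := (μ.restrict s).map (embeddingReal X) with hν
  have hν0 : ν univ ≠ 0 := by
    rw [hν, Measure.map_apply he.measurable MeasurableSet.univ]
    simpa using hs0.ne'
  obtain ⟨x, -, hx⟩ := exists_mem_forall_mem_nhdsWithin_pos_measure hν0
  have hx0 : ν {x} < δ := by
    rw [hν, Measure.map_apply he.measurable (measurableSet_singleton x)]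
    have : (embeddingReal X ⁻¹' {x}).Subsingleton :=
      subsingleton_singleton.preimage he.injective
    rwa [this.measure_zero]
  obtain ⟨U, hU, hUo, hUδ⟩ := Set.exists_isOpen_lt_of_lt {x} δ hx0
  have hpos : 0 < ν U := hx U (by
    rw [nhdsWithin_univ]
    exact hUo.mem_nhds (hU rfl))
  rw [hν, Measure.map_apply he.measurable hUo.measurableSet,
    Measure.restrict_apply (he.measurable hUo.measurableSet)] at hpos hUδ
  exact ⟨_, (he.measurable hUo.measurableSet).inter hs, hpos, hUδ⟩

end Nonatomic

/-! ### The embeddings between the spaces `X_n`. -/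

namespace CFSequence

variable (D : CFSequence)

section Levels

/-- The sequence `a, c 0, c 1, …`. -/
def cons (a : ℤ) (c : ℕ → ℤ) : ℕ → ℤ
  | 0 => a
  | i + 1 => c i

theorem continuous_cons (a : ℤ) : Continuous (cons a) :=
  continuous_pi fun i => match i with
    | 0 => continuous_const
    | i + 1 => continuous_apply i

theorem C_nonempty (n : ℕ) : (D.C (n + 1)).Nonempty :=
  Finset.card_pos.1 (zero_lt_one.trans (D.one_lt_card n))

/-- Disjointness of the translates of `F_n` makes the decomposition of an element of `F_n + C_{n+1}`
unique; injectivity of all the embeddings comes from this. -/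
theorem add_injOn {n : ℕ} {f f' c c' : ℤ} (hf : f ∈ D.F n) (hf' : f' ∈ D.F n)
    (hc : c ∈ D.C (n + 1)) (hc' : c' ∈ D.C (n + 1)) (h : f + c = f' + c') : f = f' ∧ c = c' := by
  have hcc : c = c' := by
    by_contra hne
    refine Finset.disjoint_left.1 (D.disjoint n c hc c' hc' hne)
      (Finset.add_mem_add hf (Finset.mem_singleton_self c)) ?_
    rw [h]
    exact Finset.add_mem_add hf' (Finset.mem_singleton_self c')
  subst hcc
  exact ⟨add_right_cancel h, rfl⟩

theorem step_iterate_snd (k : ℕ) (p : ℤ × (ℕ → ℤ)) (i : ℕ) :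
    (step^[k] p).2 i = p.2 (k + i) := by
  induction k generalizing p with
  | zero => simp
  | succ k ih =>
    rw [Function.iterate_succ_apply, ih]
    exact congrArg p.2 (by omega)

variable {D}

theorem next_injective {n : ℕ} : Function.Injective (Level.next : D.Level n → D.Level (n + 1)) := by
  intro u v h
  have h1 : step u.1 = step v.1 := congrArg Subtype.val h
  simp only [step, Prod.mk.injEq] at h1
  obtain ⟨h2, h3⟩ := D.add_injOn u.2.1 v.2.1 (u.2.2 0) (v.2.2 0) h1.1
  refine Subtype.ext (Prod.ext h2 (funext fun i => ?_))
  cases i with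
  | zero => exact h3
  | succ i => exact congrFun h1.2 i

/-- The point of `X_n` with first coordinates `f, c` that corresponds to a point of `X_{n+1}` with
first coordinate `f + c`. -/
def Level.prev {n : ℕ} (w : D.Level (n + 1)) {f c : ℤ} (hf : f ∈ D.F n) (hc : c ∈ D.C (n + 1)) :
    D.Level n :=
  ⟨(f, cons c w.1.2), hf, fun i => by
    cases i with
    | zero => exact hc
    | succ i =>
      have := w.2.2 i
      rwa [show n + 1 + 1 + i = n + 1 + (i + 1) by omega] at this⟩

theorem Level.next_prev {n : ℕ} (w : D.Level (n + 1)) {f c : ℤ} (hf : f ∈ D.F n)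
    (hc : c ∈ D.C (n + 1)) (hw : w.1.1 = f + c) : (w.prev hf hc).next = w :=
  Subtype.ext (Prod.ext hw.symm rfl)

theorem incl_eq_of_step_iterate {n k : ℕ} (u : D.Level n) (w : D.Level (n + k))
    (h : w.1 = step^[k] u.1) : D.incl (n + k) w = D.incl n u :=
  Quotient.sound ⟨0, k, rfl, h⟩

/-- A cylinder of `X_n` determined by the first `k + 1` coordinates is a cylinder `[f]_{n+k}`. -/
theorem exists_of_fst_eq {n : ℕ} (u : D.Level n) (k : ℕ) (w : D.Level (n + k))
    (hw : w.1.1 = (step^[k] u.1).1) :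
    ∃ u' : D.Level n, w.1 = step^[k] u'.1 ∧ u'.1.1 = u.1.1 ∧ ∀ i < k, u'.1.2 i = u.1.2 i := by
  induction k with
  | zero => exact ⟨w, rfl, hw, fun i hi => absurd hi (by omega)⟩
  | succ k ih =>
    obtain ⟨v, -, hv, -⟩ := D.exists_level_le (g := 0) u (by simpa using u.2.1) k
    have hw' : w.1.1 = v.1.1 + v.1.2 0 := by
      rw [hw, Function.iterate_succ_apply', ← hv]
      rfl
    have hnext := w.next_prev (n := n + k) v.2.1 (v.2.2 0) hw'
    obtain ⟨u', h1, h2, h3⟩ := ih (w.prev (n := n + k) v.2.1 (v.2.2 0)) (by rw [← hv]; rfl)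
    refine ⟨u', ?_, h2, fun i hi => ?_⟩
    · rw [Function.iterate_succ_apply', ← h1]
      exact (congrArg Subtype.val hnext).symm
    · rcases Nat.lt_succ_iff_lt_or_eq.1 hi with h | rfl
      · exact h3 i h
      · have h4 := step_iterate_snd i u'.1 0
        have h5 := step_iterate_snd i u.1 0
        rw [← h1] at h4
        rw [← hv] at h5
        exact h4.symm.trans h5

theorem step_iterate_injective {n k : ℕ} {u v : D.Level n} (h : step^[k] u.1 = step^[k] v.1) :
    u = v := by
  induction k with
  | zero => exact Subtype.ext h
  | succ k ih =>
    obtain ⟨u', -, hu, -⟩ := D.exists_level_le (g := 0) u (by simpa using u.2.1) k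
    obtain ⟨v', -, hv, -⟩ := D.exists_level_le (g := 0) v (by simpa using v.2.1) k
    refine ih ?_
    rw [Function.iterate_succ_apply', Function.iterate_succ_apply', ← hu, ← hv] at h
    rw [← hu, ← hv, next_injective (Subtype.ext h : u'.next = v'.next)]

variable (D)

theorem incl_injective (n : ℕ) : Function.Injective (D.incl n) := by
  intro u v h
  obtain ⟨i, j, h1, h2⟩ := Quotient.exact h
  obtain rfl : i = j := by simpa using h1
  exact step_iterate_injective h2

theorem exists_incl (x : D.Space) : ∃ n u, D.incl n u = x := by
  obtain ⟨⟨n, u⟩, rfl⟩ := Quotient.exists_rep x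
  exact ⟨n, u, rfl⟩

theorem exists_incl_of_le {n m : ℕ} (h : n ≤ m) (u : D.Level n) :
    ∃ v, D.incl m v = D.incl n u := by
  obtain ⟨k, rfl⟩ := Nat.exists_eq_add_of_le h
  obtain ⟨v, -, -, hv⟩ := D.exists_level_le (g := 0) u (by simpa using u.2.1) k
  exact ⟨v, hv⟩

theorem monotone_range_incl : Monotone fun n => range (D.incl n) := by
  rintro n m h _ ⟨u, rfl⟩
  exact D.exists_incl_of_le h u

theorem iUnion_range_incl : ⋃ n, range (D.incl n) = univ :=
  eq_univ_of_forall fun x => by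
    obtain ⟨n, u, rfl⟩ := D.exists_incl x
    exact mem_iUnion.2 ⟨n, u, rfl⟩

end Levels

/-! ### Topology and Borel structure of the inductive limit. -/

section Topology

theorem continuous_incl (n : ℕ) : Continuous (D.incl n) :=
  continuous_quotient_mk'.comp continuous_sigmaMk

variable {D} in
theorem continuous_next {n : ℕ} : Continuous (Level.next : D.Level n → D.Level (n + 1)) := by
  refine Continuous.subtype_mk ?_ _
  unfold step
  fun_prop

variable {D} in
-- The first coordinate is locally constant. Where it equals `f + c`, the map has the continuous
-- inverse that splits it back into `f` and `c`.
theorem isOpenMap_next {n : ℕ} : IsOpenMap (Level.next : D.Level n → D.Level (n + 1)) := by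
  rintro U ⟨O, hO, rfl⟩
  rw [isOpen_iff_forall_mem_open]
  rintro _ ⟨u, hu, rfl⟩
  refine ⟨{v | v.1.1 = u.1.1 + u.1.2 0 ∧ (u.1.1, cons (u.1.2 0) v.1.2) ∈ O}, ?_, ?_, rfl, ?_⟩
  · rintro v ⟨h1, h2⟩
    exact ⟨v.prev u.2.1 (u.2.2 0), h2, v.next_prev _ _ h1⟩
  · refine IsOpen.inter ?_ ?_
    · exact (isOpen_discrete {u.1.1 + u.1.2 0}).preimage
        (continuous_fst.comp continuous_subtype_val)
    · exact hO.preimage (continuous_const.prodMk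
        ((continuous_cons _).comp (continuous_snd.comp continuous_subtype_val)))
  · have : cons (u.1.2 0) u.next.1.2 = u.1.2 := by
      ext i
      cases i <;> rfl
    rw [this]
    exact hu

/-- Openness in the limit is tested in every `X_m`: above `n` the preimage is an iterated image
under open embeddings, below `n` an iterated preimage under continuous ones. -/
theorem isOpenMap_incl (n : ℕ) : IsOpenMap (D.incl n) := by
  intro U hU
  have hpre : ∀ m, D.incl m ⁻¹' (D.incl n '' U) =
      Level.next ⁻¹' (D.incl (m + 1) ⁻¹' (D.incl n '' U)) := by
    intro m
    ext v
    simp only [mem_preimage, incl_next]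
  have hup : ∀ k, IsOpen (D.incl (n + k) ⁻¹' (D.incl n '' U)) := by
    intro k
    induction k with
    | zero => rwa [add_zero, (D.incl_injective n).preimage_image]
    | succ k ih =>
      have : D.incl (n + k + 1) ⁻¹' (D.incl n '' U) =
          Level.next '' (D.incl (n + k) ⁻¹' (D.incl n '' U)) := by
        ext w
        constructor
        · rintro ⟨u, hu, huw⟩
          obtain ⟨v, hv⟩ := D.exists_incl_of_le (Nat.le_add_right n k) u
          refine ⟨v, ⟨u, hu, hv.symm⟩, D.incl_injective _ ?_⟩
          rw [incl_next, hv, huw]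
        · rintro ⟨v, hv, rfl⟩
          simpa only [mem_preimage, incl_next] using hv
      rw [← add_assoc, this]
      exact isOpenMap_next _ ih
  have hdown : ∀ k m, m + k = n → IsOpen (D.incl m ⁻¹' (D.incl n '' U)) := by
    intro k
    induction k with
    | zero => rintro m rfl; exact hup 0
    | succ k ih =>
      intro m hm
      rw [hpre m]
      exact (ih (m + 1) (by omega)).preimage continuous_next
  refine isOpen_coinduced.2 (isOpen_sigma_iff.2 fun m => ?_)
  rcases le_total n m with h | h
  · obtain ⟨k, rfl⟩ := Nat.exists_eq_add_of_le h
    exact hup k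
  · obtain ⟨k, hk⟩ := Nat.exists_eq_add_of_le h
    exact hdown k m hk.symm

theorem measurableEmbedding_incl (n : ℕ) : MeasurableEmbedding (D.incl n) :=
  (IsOpenEmbedding.of_continuous_injective_isOpenMap (D.continuous_incl n) (D.incl_injective n)
    (D.isOpenMap_incl n)).measurableEmbedding

theorem measurableSet_fst_mem (n : ℕ) (A : Set ℤ) : MeasurableSet {u : D.Level n | u.1.1 ∈ A} :=
  (measurable_fst.comp measurable_subtype_coe) (MeasurableSet.of_discrete (s := A))

theorem measurableSet_cylinder (n : ℕ) (A : Set ℤ) : MeasurableSet (D.cylinder n A) :=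
  (D.measurableEmbedding_incl n).measurableSet_image.2 (D.measurableSet_fst_mem n A)

theorem measurableSet_dom (g : ℤ) : MeasurableSet (D.dom g) :=
  MeasurableSet.iUnion fun n => (D.measurableEmbedding_incl n).measurableSet_image.2
    (D.measurableSet_fst_mem n {f | g + f ∈ D.F n})

theorem measurableSet_core : MeasurableSet D.core :=
  MeasurableSet.iInter fun g => D.measurableSet_dom g

theorem cylinder_univ (n : ℕ) : D.cylinder n univ = range (D.incl n) := by
  simp [cylinder]

theorem cylinder_subset_range (n : ℕ) (A : Set ℤ) : D.cylinder n A ⊆ range (D.incl n) :=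
  image_subset_range _ _

/-- The cylinders of `X_n` are cylinders of `X_m` for `m ≥ n`. -/
theorem exists_cylinder_eq {n m : ℕ} (h : n ≤ m) (A : Set ℤ) :
    ∃ A' ⊆ (D.F m : Set ℤ), D.cylinder n A = D.cylinder m A' := by
  obtain ⟨k, rfl⟩ := Nat.exists_eq_add_of_le h
  refine ⟨{f | ∃ v : D.Level (n + k), v.1.1 = f ∧ D.incl (n + k) v ∈ D.cylinder n A}, ?_, ?_⟩
  · rintro _ ⟨v, rfl, -⟩
    exact v.2.1
  ext x
  constructor
  · rintro ⟨u, hu, rfl⟩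
    obtain ⟨v, hv⟩ := D.exists_incl_of_le h u
    rw [← hv]
    exact ⟨v, ⟨v, rfl, by rw [hv]; exact ⟨u, hu, rfl⟩⟩, rfl⟩
  · rintro ⟨w, ⟨v, hvw, u, hu, huv⟩, rfl⟩
    obtain ⟨v', -, hv', hv'u⟩ := D.exists_level_le (g := 0) u (by simpa using u.2.1) k
    obtain rfl : v' = v := D.incl_injective _ (hv'u.trans huv)
    obtain ⟨u', h1, h2, -⟩ := exists_of_fst_eq u k w (by rw [← hvw, hv'])
    refine ⟨u', ?_, (incl_eq_of_step_iterate u' w h1).symm⟩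
    change u'.1.1 ∈ A
    rw [h2]
    exact hu

/-- Two cylinders can be rewritten at a common level, where injectivity of the inclusion reduces the
operations to subsets of `ℤ`. -/
theorem isSetRing_cylinders : IsSetRing {s | ∃ n A, s = D.cylinder n A} where
  empty_mem := ⟨0, ∅, by simp [cylinder]⟩
  union_mem := by
    rintro _ _ ⟨n, A, rfl⟩ ⟨m, A', rfl⟩
    obtain ⟨E, -, hE⟩ := D.exists_cylinder_eq (le_max_left n m) A
    obtain ⟨E', -, hE'⟩ := D.exists_cylinder_eq (le_max_right n m) A'
    refine ⟨max n m, E ∪ E', ?_⟩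
    rw [hE, hE', cylinder, cylinder, ← image_union]
    rfl
  sdiff_mem := by
    rintro _ _ ⟨n, A, rfl⟩ ⟨m, A', rfl⟩
    obtain ⟨E, -, hE⟩ := D.exists_cylinder_eq (le_max_left n m) A
    obtain ⟨E', -, hE'⟩ := D.exists_cylinder_eq (le_max_right n m) A'
    refine ⟨max n m, E \ E', ?_⟩
    rw [hE, hE', cylinder, cylinder, ← image_sdiff (D.incl_injective _)]
    rfl

theorem exists_cylinder_subset_of_isOpen {O : Set D.Space} (hO : IsOpen O) {x : D.Space}
    (hx : x ∈ O) : ∃ n f, x ∈ D.cylinder n {f} ∧ D.cylinder n {f} ⊆ O := by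
  obtain ⟨n, u, rfl⟩ := D.exists_incl x
  obtain ⟨O', hO', hO'eq⟩ := hO.preimage (D.continuous_incl n)
  have hu : u.1 ∈ O' := by
    change u ∈ Subtype.val ⁻¹' O'
    rw [hO'eq]
    exact hx
  obtain ⟨V, W, -, hW, huV, huW, hVW⟩ := isOpen_prod_iff.1 hO' u.1.1 u.1.2 hu
  obtain ⟨I, t, ht, hIt⟩ := isOpen_pi_iff.1 hW u.1.2 huW
  -- A basic neighbourhood restricts finitely many coordinates, all before `K`; the first coordinate
  -- at level `n + K` determines them on `X_n`.
  obtain ⟨K, hK⟩ : ∃ K, ∀ i ∈ I, i < K := ⟨I.sup id + 1, fun i hi =>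
    Nat.lt_succ_of_le (Finset.le_sup (f := id) hi)⟩
  obtain ⟨v, -, hv, hvu⟩ := D.exists_level_le (g := 0) u (by simpa using u.2.1) K
  refine ⟨n + K, v.1.1, ?_, ?_⟩
  · rw [← hvu]
    exact ⟨v, rfl, rfl⟩
  · rintro _ ⟨w, hw, rfl⟩
    obtain ⟨u', h1, h2, h3⟩ := exists_of_fst_eq u K w (by rw [← hv]; exact hw)
    rw [incl_eq_of_step_iterate u' w h1]
    change u' ∈ D.incl n ⁻¹' O
    rw [← hO'eq]
    refine hVW ⟨?_, hIt fun i hi => ?_⟩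
    · rw [h2]; exact huV
    · rw [h3 i (hK i hi)]; exact (ht i hi).2

theorem borel_eq_generateFrom_cylinders :
    (inferInstance : MeasurableSpace D.Space) =
      MeasurableSpace.generateFrom {s | ∃ n A, s = D.cylinder n A} := by
  refine le_antisymm ?_ (MeasurableSpace.generateFrom_le ?_)
  · refine MeasurableSpace.generateFrom_le fun O hO => ?_
    have : O = ⋃ p : {p : ℕ × ℤ // D.cylinder p.1 {p.2} ⊆ O}, D.cylinder p.1.1 {p.1.2} := by
      refine subset_antisymm (fun x hx => ?_) (iUnion_subset fun p => p.2)
      obtain ⟨n, f, h1, h2⟩ := D.exists_cylinder_subset_of_isOpen hO hx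
      exact mem_iUnion.2 ⟨⟨(n, f), h2⟩, h1⟩
    rw [this]
    exact MeasurableSet.iUnion fun p => MeasurableSpace.measurableSet_generateFrom ⟨_, _, rfl⟩
  · rintro _ ⟨n, A, rfl⟩
    exact D.measurableSet_cylinder n A

end Topology

end CFSequence

/-! ### Splitting the first factor off an infinite product measure. -/

namespace CFSequence

section ProductMeasure

theorem measurable_cons : Measurable fun q : ℤ × (ℕ → ℤ) => cons q.1 q.2 :=
  measurable_pi_lambda _ fun i => match i with
    | 0 => measurable_fst
    | i + 1 => (measurable_pi_apply i).comp measurable_snd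

theorem infinitePi_eq_map_cons (ρ : ℕ → Measure ℤ) [∀ i, IsProbabilityMeasure (ρ i)] :
    Measure.infinitePi ρ =
      ((ρ 0).prod (Measure.infinitePi fun i => ρ (i + 1))).map fun q => cons q.1 q.2 := by
  classical
  symm
  refine Measure.eq_infinitePi ρ fun s t ht => ?_
  obtain ⟨N, hN⟩ : ∃ N, s ⊆ Finset.range (N + 1) := ⟨s.sup id, fun i hi =>
    Finset.mem_range.2 (Nat.lt_succ_of_le (Finset.le_sup (f := id) hi))⟩
  -- Padding with the whole space turns an arbitrary finite box into one over an initial segment, on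
  -- which prepending a coordinate is a shift of indices.
  set t' : ℕ → Set ℤ := fun i => if i ∈ s then t i else univ with ht'
  have h1 : Set.pi (s : Set ℕ) t = Set.pi (Finset.range (N + 1) : Set ℕ) t' := by
    ext c
    simp only [Set.mem_pi, Finset.mem_coe, ht']
    constructor
    · intro h i _
      split_ifs with hi
      · exact h i hi
      · trivial
    · intro h i hi
      have := h i (hN hi)
      rwa [if_pos hi] at this
  have h2 : ∏ i ∈ s, ρ i (t i) = ∏ i ∈ Finset.range (N + 1), ρ i (t' i) := by
    refine (Finset.prod_congr rfl fun i hi => ?_).trans (Finset.prod_subset hN fun i _ hi => ?_)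
    · simp [ht', hi]
    · simp [ht', hi]
  have h3 : (fun q : ℤ × (ℕ → ℤ) => cons q.1 q.2) ⁻¹' Set.pi (Finset.range (N + 1) : Set ℕ) t' =
      t' 0 ×ˢ Set.pi (Finset.range N : Set ℕ) fun i => t' (i + 1) := by
    ext q
    simp only [mem_preimage, Set.mem_pi, Finset.coe_range, mem_Iio, mem_prod]
    constructor
    · exact fun h => ⟨h 0 (by omega), fun i hi => h (i + 1) (by omega)⟩
    · rintro ⟨h0, h⟩ i hi
      cases i with
      | zero => exact h0
      | succ i => exact h i (by omega)
  rw [h1, h2, Measure.map_apply measurable_cons (MeasurableSet.pi (Finset.countable_toSet _)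
    fun _ _ => MeasurableSet.of_discrete), h3, Measure.prod_prod,
    Measure.infinitePi_pi _ fun _ _ => MeasurableSet.of_discrete, Finset.prod_range_succ', mul_comm]

theorem uniformOn_prod_apply {A : Finset ℤ} {β : Type*} [MeasurableSpace β] (ν : Measure β)
    [SFinite ν] {V : Set (ℤ × β)} (hV : MeasurableSet V) :
    ((ProbabilityTheory.uniformOn (A : Set ℤ)).prod ν) V =
      (A.card : ℝ≥0∞)⁻¹ * ∑ a ∈ A, ν (Prod.mk a ⁻¹' V) := by
  rw [Measure.prod_apply hV, ProbabilityTheory.uniformOn, ProbabilityTheory.cond,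
    lintegral_smul_measure, lintegral_finset]
  simp

end ProductMeasure

/-! ### The measures on the spaces `X_n`. -/

variable (D : CFSequence)

section LevelMeasure

/-- The product of the uniform measures on `C_{n+1}, C_{n+2}, …`. -/
noncomputable def tail (n : ℕ) : Measure (ℕ → ℤ) :=
  Measure.infinitePi fun i : ℕ => ProbabilityTheory.uniformOn (D.C (n + 1 + i) : Set ℤ)

/-- The product `#C_1 ⋯ #C_n`. -/
noncomputable def cardProd (n : ℕ) : ℝ≥0∞ := ∏ j ∈ Finset.Icc 1 n, ((D.C j).card : ℝ≥0∞)

instance (n i : ℕ) :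
    IsProbabilityMeasure (ProbabilityTheory.uniformOn (D.C (n + 1 + i) : Set ℤ)) := by
  refine ProbabilityTheory.isProbabilityMeasure_uniformOn (Finset.finite_toSet _) ?_
  rw [show n + 1 + i = n + i + 1 by omega]
  exact D.C_nonempty (n + i)

instance (n : ℕ) : IsProbabilityMeasure (D.tail n) := by
  unfold tail
  infer_instance

theorem cardProd_succ (n : ℕ) : D.cardProd (n + 1) = D.cardProd n * (D.C (n + 1)).card :=
  Finset.prod_Icc_succ_top (by omega) _

theorem two_pow_le_cardProd (n : ℕ) : 2 ^ n ≤ D.cardProd n := by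
  induction n with
  | zero => simp [cardProd]
  | succ n ih =>
    rw [cardProd_succ, pow_succ]
    gcongr
    exact_mod_cast D.one_lt_card n

theorem cardProd_ne_zero (n : ℕ) : D.cardProd n ≠ 0 :=
  ((ENNReal.pow_pos two_pos n).trans_le (D.two_pow_le_cardProd n)).ne'

theorem cardProd_ne_top (n : ℕ) : D.cardProd n ≠ ∞ :=
  ENNReal.prod_ne_top fun _ _ => ENNReal.natCast_ne_top _

theorem tail_preimage (n : ℕ) {V : Set (ℤ × (ℕ → ℤ))} (hV : MeasurableSet V) :
    D.tail n ((fun c => (c 0, fun i => c (i + 1))) ⁻¹' V) =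
      ((D.C (n + 1)).card : ℝ≥0∞)⁻¹ * ∑ a ∈ D.C (n + 1), D.tail (n + 1) (Prod.mk a ⁻¹' V) := by
  have hm : Measurable fun c : ℕ → ℤ => (c 0, fun i => c (i + 1)) := by fun_prop
  have htail : D.tail (n + 1) = Measure.infinitePi fun i : ℕ =>
      ProbabilityTheory.uniformOn (D.C (n + 1 + (i + 1)) : Set ℤ) := by
    unfold tail
    congr 1
    funext i
    rw [show n + 1 + 1 + i = n + 1 + (i + 1) by omega]
  rw [tail, infinitePi_eq_map_cons, Measure.map_apply measurable_cons (hm hV), htail,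
    ← uniformOn_prod_apply _ hV]
  rfl

theorem measurableSet_level (n : ℕ) :
    MeasurableSet {p : ℤ × (ℕ → ℤ) | p.1 ∈ D.F n ∧ ∀ i, p.2 i ∈ D.C (n + 1 + i)} := by
  have h : {p : ℤ × (ℕ → ℤ) | p.1 ∈ D.F n ∧ ∀ i, p.2 i ∈ D.C (n + 1 + i)} =
      Prod.fst ⁻¹' (D.F n : Set ℤ) ∩ ⋂ i, (fun p : ℤ × (ℕ → ℤ) => p.2 i) ⁻¹' (D.C (n + 1 + i) : Set ℤ) := by
    ext p
    simp
  rw [h]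
  exact (measurable_fst MeasurableSet.of_discrete).inter (MeasurableSet.iInter fun i =>
    ((measurable_pi_apply i).comp measurable_snd) MeasurableSet.of_discrete)

theorem measurableEmbedding_val (n : ℕ) :
    MeasurableEmbedding (Subtype.val : D.Level n → ℤ × (ℕ → ℤ)) :=
  MeasurableEmbedding.subtype_coe (D.measurableSet_level n)

theorem ae_tail (n : ℕ) : ∀ᵐ c ∂D.tail n, ∀ i, c i ∈ D.C (n + 1 + i) := by
  refine ae_all_iff.2 fun i => ?_
  have h1 : ∀ᵐ a ∂ProbabilityTheory.uniformOn (D.C (n + 1 + i) : Set ℤ), a ∈ D.C (n + 1 + i) :=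
    ProbabilityTheory.ae_cond_mem (MeasurableSet.of_discrete (s := (D.C (n + 1 + i) : Set ℤ)))
  exact (measurePreserving_eval_infinitePi (fun i =>
    ProbabilityTheory.uniformOn (D.C (n + 1 + i) : Set ℤ)) i).quasiMeasurePreserving.ae h1

theorem levelMeasure_preimage (n : ℕ) {V : Set (ℤ × (ℕ → ℤ))} (hV : MeasurableSet V) :
    D.levelMeasure n (Subtype.val ⁻¹' V) =
      (D.cardProd n)⁻¹ * ∑ f ∈ D.F n, D.tail n (Prod.mk f ⁻¹' V) := by
  change ((D.cardProd n)⁻¹ • ((Measure.count.restrict (D.F n : Set ℤ)).prod (D.tail n)).comap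
    Subtype.val) (Subtype.val ⁻¹' V) = _
  have himg : (Subtype.val : D.Level n → ℤ × (ℕ → ℤ)) '' (Subtype.val ⁻¹' V) =
      {p | p.1 ∈ D.F n ∧ ∀ i, p.2 i ∈ D.C (n + 1 + i)} ∩ V := by
    ext p
    constructor
    · rintro ⟨u, hu, rfl⟩
      exact ⟨u.2, hu⟩
    · rintro ⟨hp, hpV⟩
      exact ⟨⟨p, hp⟩, hpV, rfl⟩
  rw [Measure.smul_apply, smul_eq_mul, (D.measurableEmbedding_val n).comap_apply, himg,
    Measure.prod_apply ((D.measurableSet_level n).inter hV), lintegral_finset]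
  congr 1
  refine Finset.sum_congr rfl fun f hf => ?_
  rw [Measure.count_singleton, mul_one]
  refine measure_congr ?_
  filter_upwards [D.ae_tail n] with c hc
  refine propext ?_
  change (f, c) ∈ _ ↔ (f, c) ∈ V
  exact ⟨fun h => h.2, fun h => ⟨⟨hf, hc⟩, h⟩⟩

/-- Summing over all of `ℤ` instead of `F_n` makes translation of the first coordinate a mere
reindexing. -/
theorem levelMeasure_eq_tsum (n : ℕ) {V : Set (ℤ × (ℕ → ℤ))} (hV : MeasurableSet V)
    (hVF : ∀ p ∈ V, p.1 ∈ D.F n) :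
    D.levelMeasure n (Subtype.val ⁻¹' V) =
      (D.cardProd n)⁻¹ * ∑' f : ℤ, D.tail n (Prod.mk f ⁻¹' V) := by
  rw [D.levelMeasure_preimage n hV, tsum_eq_sum]
  intro f hf
  have : Prod.mk f ⁻¹' V = ∅ := eq_empty_of_forall_notMem fun c hc => hf (hVF _ hc)
  rw [this, measure_empty]

theorem levelMeasure_fst_mem (n : ℕ) (A : Finset ℤ) :
    D.levelMeasure n {u | u.1.1 ∈ A} = (D.cardProd n)⁻¹ * (A ∩ D.F n).card := by
  have hV : MeasurableSet {p : ℤ × (ℕ → ℤ) | p.1 ∈ A} :=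
    measurable_fst (MeasurableSet.of_discrete (s := (A : Set ℤ)))
  have h := D.levelMeasure_preimage n hV
  refine h.trans ?_
  congr 1
  have : ∀ f, D.tail n (Prod.mk f ⁻¹' {p : ℤ × (ℕ → ℤ) | p.1 ∈ A}) =
      if f ∈ A then 1 else 0 := by
    intro f
    by_cases hf : f ∈ A <;> simp [hf]
  simp_rw [this]
  rw [Finset.sum_ite_mem, Finset.inter_comm]
  simp

theorem levelMeasure_univ (n : ℕ) :
    D.levelMeasure n univ = (D.cardProd n)⁻¹ * (D.F n).card := by
  have h := D.levelMeasure_fst_mem n (D.F n)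
  rw [Finset.inter_self] at h
  rw [← h]
  congr 1
  exact (eq_univ_of_forall fun u => u.2.1).symm

theorem levelMeasure_univ_lt_top (n : ℕ) : D.levelMeasure n univ < ∞ := by
  rw [levelMeasure_univ]
  exact ENNReal.mul_lt_top (ENNReal.inv_lt_top.2 (D.cardProd_ne_zero n).bot_lt) (by simp)

theorem levelMeasure_translate (n : ℕ) (g : ℤ) {W W' : Set (D.Level n)} (hW : MeasurableSet W)
    (h1 : ∀ u ∈ W, g + u.1.1 ∈ D.F n)
    (h2 : W' = {v | ∃ u ∈ W, (g + u.1.1, u.1.2) = v.1}) :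
    MeasurableSet W' ∧ D.levelMeasure n W' = D.levelMeasure n W := by
  set V := Subtype.val '' W with hV
  have hVm : MeasurableSet V := (D.measurableEmbedding_val n).measurableSet_image.2 hW
  have hVW : W = Subtype.val ⁻¹' V := (preimage_image_eq _ Subtype.val_injective).symm
  have hτm : Measurable fun p : ℤ × (ℕ → ℤ) => (p.1 - g, p.2) :=
    (measurable_fst.sub_const g).prodMk measurable_snd
  set V' : Set (ℤ × (ℕ → ℤ)) := (fun p => (p.1 - g, p.2)) ⁻¹' V with hV'
  have hV'W' : W' = Subtype.val ⁻¹' V' := by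
    rw [h2]
    ext v
    simp only [mem_ofPred_eq, mem_preimage, hV', hV, mem_image]
    refine exists_congr fun u => and_congr_right fun _ => ?_
    rw [Prod.ext_iff, Prod.ext_iff]
    simp only
    refine and_congr_left fun _ => ?_
    omega
  have hV'F : ∀ p ∈ V', p.1 ∈ D.F n := by
    rintro p ⟨u, hu, hup⟩
    have := h1 u hu
    rw [hup] at this
    simpa using this
  have hVF : ∀ p ∈ V, p.1 ∈ D.F n := by
    rintro _ ⟨u, -, rfl⟩
    exact u.2.1
  refine ⟨hV'W' ▸ measurable_subtype_coe (hτm hVm), ?_⟩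
  rw [hV'W', hVW, D.levelMeasure_eq_tsum n (hτm hVm) hV'F, D.levelMeasure_eq_tsum n hVm hVF]
  congr 1
  exact (Equiv.subRight g).tsum_eq fun f => D.tail n (Prod.mk f ⁻¹' V)

/-- This is the consistency of the level measures. Conditioning on `c_{n+1}` splits the fibre over
`f` into the fibres over `f + a`, each with weight `1 / #C_{n+1}`. The sums are distinct, and the
elements of `F_{n+1}` outside `F_n + C_{n+1}` carry empty fibres. -/
theorem levelMeasure_next (n : ℕ) {W : Set (D.Level n)} (hW : MeasurableSet W) :
    D.levelMeasure (n + 1) (Level.next '' W) = D.levelMeasure n W := by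
  classical
  have hemb : MeasurableEmbedding (Level.next : D.Level n → D.Level (n + 1)) :=
    (IsOpenEmbedding.of_continuous_injective_isOpenMap continuous_next next_injective
      isOpenMap_next).measurableEmbedding
  set V : Set (ℤ × (ℕ → ℤ)) := Subtype.val '' (Level.next '' W) with hV
  have hVm : MeasurableSet V :=
    (D.measurableEmbedding_val (n + 1)).measurableSet_image.2 (hemb.measurableSet_image.2 hW)
  have hnext : Level.next '' W = Subtype.val ⁻¹' V :=
    (preimage_image_eq _ Subtype.val_injective).symm
  have hstep : Measurable step := by unfold step; fun_prop
  have hWV : W = Subtype.val ⁻¹' (step ⁻¹' V) := by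
    ext u
    constructor
    · exact fun hu => ⟨u.next, mem_image_of_mem _ hu, rfl⟩
    · rintro ⟨_, ⟨u', hu', rfl⟩, h⟩
      rwa [← next_injective (Subtype.ext h : u'.next = u.next)]
  rw [hnext, D.levelMeasure_preimage (n + 1) hVm]
  conv_rhs => rw [hWV]
  rw [D.levelMeasure_preimage n (hstep hVm)]
  have hsec : ∀ f ∈ D.F n, D.tail n (Prod.mk f ⁻¹' (step ⁻¹' V)) =
      ((D.C (n + 1)).card : ℝ≥0∞)⁻¹ *
        ∑ a ∈ D.C (n + 1), D.tail (n + 1) (Prod.mk (f + a) ⁻¹' V) := by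
    intro f _
    have hm : Measurable fun p : ℤ × (ℕ → ℤ) => (f + p.1, p.2) :=
      (measurable_fst.const_add f).prodMk measurable_snd
    exact D.tail_preimage n (hm hVm)
  rw [Finset.sum_congr rfl hsec, ← Finset.mul_sum, ← mul_assoc, cardProd_succ,
    ENNReal.mul_inv (Or.inl (D.cardProd_ne_zero n)) (Or.inl (D.cardProd_ne_top n))]
  congr 1
  rw [← Finset.sum_product' (f := fun f a => D.tail (n + 1) (Prod.mk (f + a) ⁻¹' V))]
  have hinj : Set.InjOn (fun q : ℤ × ℤ => q.1 + q.2) (D.F n ×ˢ D.C (n + 1) : Finset (ℤ × ℤ)) := by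
    intro p hp q hq hpq
    have hp' := Finset.mem_product.1 (Finset.mem_coe.1 hp)
    have hq' := Finset.mem_product.1 (Finset.mem_coe.1 hq)
    obtain ⟨h1, h2⟩ := D.add_injOn hp'.1 hq'.1 hp'.2 hq'.2 hpq
    exact Prod.ext h1 h2
  rw [← Finset.sum_image (f := fun f => D.tail (n + 1) (Prod.mk f ⁻¹' V)) hinj]
  symm
  refine Finset.sum_subset ?_ ?_
  · intro f hf
    obtain ⟨q, hq, rfl⟩ := Finset.mem_image.1 hf
    have hq' := Finset.mem_product.1 hq
    exact D.add_subset n (Finset.add_mem_add hq'.1 hq'.2)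
  · intro f _ hf
    have : Prod.mk f ⁻¹' V = ∅ := by
      refine eq_empty_of_forall_notMem fun c hc => hf ?_
      obtain ⟨_, ⟨u, -, rfl⟩, hu⟩ := hc
      exact Finset.mem_image.2 ⟨(u.1.1, u.1.2 0), Finset.mem_product.2 ⟨u.2.1, u.2.2 0⟩,
        congrArg Prod.fst hu⟩
    rw [this, measure_empty]

end LevelMeasure

/-! ### The glued measure on the inductive limit. -/

section SpaceMeasure

theorem map_incl_apply_of_subset {n m : ℕ} (h : n ≤ m) {A : Set D.Space} (hA : MeasurableSet A)
    (hAn : A ⊆ range (D.incl n)) :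
    (D.levelMeasure m).map (D.incl m) A = (D.levelMeasure n).map (D.incl n) A := by
  induction m, h using Nat.le_induction with
  | base => rfl
  | succ m hm ih =>
    rw [← ih, (D.measurableEmbedding_incl _).map_apply, (D.measurableEmbedding_incl _).map_apply,
      ← D.levelMeasure_next m ((D.continuous_incl m).measurable hA)]
    congr 1
    ext w
    constructor
    · intro hw
      obtain ⟨u, hu⟩ := D.monotone_range_incl hm (hAn hw)
      refine ⟨u, ?_, D.incl_injective _ ?_⟩
      · rw [mem_preimage, hu]
        exact hw
      · rw [incl_next, hu]
    · rintro ⟨u, hu, rfl⟩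
      rwa [mem_preimage, incl_next]

theorem measurableSet_range_incl (n : ℕ) : MeasurableSet (range (D.incl n)) :=
  (D.measurableEmbedding_incl n).measurableSet_range

/-- By consistency, the part of `A` in each piece of the gluing has the same measure computed at
level `m` or at level `n`; these parts partition `A`. -/
theorem measure_apply_of_subset (n : ℕ) {A : Set D.Space} (hA : MeasurableSet A)
    (hAn : A ⊆ range (D.incl n)) :
    D.measure A = (D.levelMeasure n).map (D.incl n) A := by
  set R : ℕ → Set D.Space := fun m => range (D.incl m) with hR
  have hdm : ∀ m, MeasurableSet (disjointed R m) := fun m =>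
    MeasurableSet.disjointed D.measurableSet_range_incl m
  have hterm : ∀ m, ((D.levelMeasure m).map (D.incl m)).restrict (disjointed R m) A =
      (D.levelMeasure n).map (D.incl n) (A ∩ disjointed R m) := by
    intro m
    rw [Measure.restrict_apply hA]
    rcases le_total m n with h | h
    · exact (D.map_incl_apply_of_subset h (hA.inter (hdm m))
        (inter_subset_right.trans (disjointed_subset _ _))).symm
    · exact D.map_incl_apply_of_subset h (hA.inter (hdm m)) (inter_subset_left.trans hAn)
  rw [measure, Measure.sum_apply _ hA, tsum_congr hterm, ← measure_iUnion, ← inter_iUnion,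
    iUnion_disjointed, hR, D.iUnion_range_incl, inter_univ]
  · exact fun i j hij => (disjoint_disjointed R hij).mono inter_subset_right inter_subset_right
  · exact fun m => hA.inter (hdm m)

theorem measure_image_incl (n : ℕ) {W : Set (D.Level n)} (hW : MeasurableSet W) :
    D.measure (D.incl n '' W) = D.levelMeasure n W := by
  rw [D.measure_apply_of_subset n ((D.measurableEmbedding_incl n).measurableSet_image.2 hW)
    (image_subset_range _ _), (D.measurableEmbedding_incl n).map_apply,
    preimage_image_eq _ (D.incl_injective n)]

theorem measure_cylinder (n : ℕ) (A : Finset ℤ) :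
    D.measure (D.cylinder n A) = (D.cardProd n)⁻¹ * (A ∩ D.F n).card := by
  rw [cylinder, D.measure_image_incl n (D.measurableSet_fst_mem n A), ← levelMeasure_fst_mem]
  rfl

theorem measure_range_incl (n : ℕ) :
    D.measure (range (D.incl n)) = (D.cardProd n)⁻¹ * (D.F n).card := by
  rw [← image_univ, D.measure_image_incl n MeasurableSet.univ, levelMeasure_univ]

theorem measure_range_incl_lt_top (n : ℕ) : D.measure (range (D.incl n)) < ∞ := by
  rw [← image_univ, D.measure_image_incl n MeasurableSet.univ]
  exact D.levelMeasure_univ_lt_top n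

end SpaceMeasure

end CFSequence

/-! ### The action is measurable and measure preserving. -/

namespace CFSequence

variable (D : CFSequence)

section Action

theorem coe_vadd_eq (g : ℤ) (y : D.core) {n : ℕ} (u : D.Level n) (hu : g + u.1.1 ∈ D.F n)
    (h : D.incl n u = y.1) : (g +ᵥ y).1 = D.incl n (u.translate g hu) :=
  D.act_eq g (mem_iInter.1 y.2 g) u hu h

theorem image_val_vadd (g : ℤ) (A : Set D.core) :
    (Subtype.val '' (g +ᵥ A) : Set D.Space) = ⋃ n, D.incl n ''
      {v | ∃ u ∈ {u : D.Level n | D.incl n u ∈ (Subtype.val '' A : Set D.Space) ∧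
        g + u.1.1 ∈ D.F n}, (g + u.1.1, u.1.2) = v.1} := by
  ext x
  simp only [mem_iUnion]
  constructor
  · rintro ⟨_, ⟨y, hy, rfl⟩, rfl⟩
    obtain ⟨n, u, hu, huy⟩ := D.exists_of_mem_dom (mem_iInter.1 y.2 g)
    refine ⟨n, u.translate g hu, ⟨u, ⟨?_, hu⟩, rfl⟩, (D.coe_vadd_eq g y u hu huy).symm⟩
    rw [huy]
    exact mem_image_of_mem _ hy
  · rintro ⟨n, v, ⟨u, ⟨⟨y, hy, hyu⟩, hu⟩, huv⟩, rfl⟩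
    refine ⟨g +ᵥ y, Set.vadd_mem_vadd_set hy, ?_⟩
    rw [D.coe_vadd_eq g y u hu hyu.symm]
    exact congrArg _ (Subtype.ext huv)

theorem image_val_eq_iUnion (g : ℤ) (A : Set D.core) :
    (Subtype.val '' A : Set D.Space) = ⋃ n, D.incl n ''
      {u : D.Level n | D.incl n u ∈ (Subtype.val '' A : Set D.Space) ∧ g + u.1.1 ∈ D.F n} := by
  ext x
  simp only [mem_iUnion]
  constructor
  · rintro ⟨y, hy, rfl⟩
    obtain ⟨n, u, hu, huy⟩ := D.exists_of_mem_dom (mem_iInter.1 y.2 g)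
    refine ⟨n, u, ⟨?_, hu⟩, huy⟩
    rw [huy]
    exact mem_image_of_mem _ hy
  · rintro ⟨n, u, ⟨h, -⟩, rfl⟩
    exact h

theorem monotone_image_incl (g : ℤ) (A : Set D.Space) : Monotone fun n => D.incl n ''
    {u : D.Level n | D.incl n u ∈ A ∧ g + u.1.1 ∈ D.F n} := by
  rintro n m h _ ⟨u, ⟨hu, hg⟩, rfl⟩
  obtain ⟨k, rfl⟩ := Nat.exists_eq_add_of_le h
  obtain ⟨v, hv, -, hvu⟩ := D.exists_level_le u hg k
  exact ⟨v, ⟨by rwa [hvu], hv⟩, hvu⟩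

theorem monotone_image_incl_vadd (g : ℤ) (A : Set D.Space) : Monotone fun n => D.incl n ''
    {v | ∃ u ∈ {u : D.Level n | D.incl n u ∈ A ∧ g + u.1.1 ∈ D.F n},
      (g + u.1.1, u.1.2) = v.1} := by
  rintro n m h _ ⟨w, ⟨u, ⟨hu, hg⟩, huw⟩, rfl⟩
  obtain ⟨k, rfl⟩ := Nat.exists_eq_add_of_le h
  obtain ⟨v, hv, -, hvu⟩ := D.exists_level_le u hg k
  refine ⟨v.translate g hv, ⟨v, ⟨by rwa [hvu], hv⟩, rfl⟩, ?_⟩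
  rw [D.incl_translate_eq g v u hv hg hvu]
  exact congrArg _ (Subtype.ext huw)

theorem measurableEmbedding_val_core :
    MeasurableEmbedding (Subtype.val : D.core → D.Space) :=
  MeasurableEmbedding.subtype_coe D.measurableSet_core

/-- A set and its translate are increasing unions of corresponding pieces, on each of which the
action just shifts the first coordinate of `X_n`. Corresponding pieces have equal measure, and
continuity from below concludes. -/
theorem measurableSet_and_measure_vadd (g : ℤ) {A : Set D.core} (hA : MeasurableSet A) :
    MeasurableSet (g +ᵥ A) ∧ D.coreMeasure (g +ᵥ A) = D.coreMeasure A := by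
  have hA' := D.measurableEmbedding_val_core.measurableSet_image.2 hA
  have hW : ∀ n, MeasurableSet {u : D.Level n | D.incl n u ∈ (Subtype.val '' A : Set D.Space) ∧
      g + u.1.1 ∈ D.F n} := fun n =>
    ((D.continuous_incl n).measurable hA').inter (D.measurableSet_fst_mem n {f | g + f ∈ D.F n})
  have key := fun n => D.levelMeasure_translate n g (hW n) (fun u hu => hu.2) rfl
  constructor
  · rw [← D.measurableEmbedding_val_core.measurableSet_image, image_val_vadd]
    exact MeasurableSet.iUnion fun n =>
      (D.measurableEmbedding_incl n).measurableSet_image.2 (key n).1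
  · rw [coreMeasure, D.measurableEmbedding_val_core.comap_apply,
      D.measurableEmbedding_val_core.comap_apply, image_val_vadd, D.image_val_eq_iUnion g A,
      (D.monotone_image_incl_vadd g _).measure_iUnion, (D.monotone_image_incl g _).measure_iUnion]
    rw [← D.image_val_eq_iUnion g A]
    refine iSup_congr fun n => ?_
    rw [D.measure_image_incl n (key n).1, D.measure_image_incl n (hW n), (key n).2]

instance : MeasurableConstVAdd ℤ D.core where
  measurable_const_vadd g A hA := by
    rw [Set.preimage_vadd]
    exact (D.measurableSet_and_measure_vadd (-g) hA).1

instance : VAddInvariantMeasure ℤ D.core D.coreMeasure where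
  measure_preimage_vadd g A hA := by
    rw [Set.preimage_vadd]
    exact (D.measurableSet_and_measure_vadd (-g) hA).2

theorem coreMeasure_apply (A : Set D.core) : D.coreMeasure A = D.measure (Subtype.val '' A) := by
  rw [coreMeasure, D.measurableEmbedding_val_core.comap_apply]

theorem coreMeasure_preimage_le (A : Set D.Space) :
    D.coreMeasure (Subtype.val ⁻¹' A) ≤ D.measure A := by
  rw [coreMeasure_apply]
  exact measure_mono (image_preimage_subset _ _)

instance : SigmaFinite D.coreMeasure := by
  refine ⟨⟨⟨fun n => Subtype.val ⁻¹' range (D.incl n), fun _ => trivial, fun n => ?_, ?_⟩⟩⟩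
  · exact (D.coreMeasure_preimage_le _).trans_lt (D.measure_range_incl_lt_top n)
  · rw [← preimage_iUnion, D.iUnion_range_incl, preimage_univ]

end Action

/-! ### The action is defined almost everywhere. -/

section AlmostEverywhere

theorem F_nonempty (n : ℕ) : (D.F n).Nonempty := by
  induction n with
  | zero => rw [D.F_zero]; exact Finset.singleton_nonempty 0
  | succ n ih => exact (ih.add (D.C_nonempty n)).mono (D.add_subset n)

/-- The indices of the cylinders `[f]_{n+k}` that make up `X_n`. -/
theorem subset_and_cylinder_subset (n k : ℕ) :
    D.F n + ∑ j ∈ Finset.Ioc n (n + k), D.C j ⊆ D.F (n + k) ∧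
      D.cylinder (n + k) (D.F n + ∑ j ∈ Finset.Ioc n (n + k), D.C j : Finset ℤ) ⊆
        range (D.incl n) := by
  induction k with
  | zero =>
    simp only [add_zero, Finset.Ioc_self, Finset.sum_empty]
    exact ⟨subset_rfl, D.cylinder_subset_range n _⟩
  | succ k ih =>
    have hsum : D.F n + ∑ j ∈ Finset.Ioc n (n + (k + 1)), D.C j =
        D.F n + ∑ j ∈ Finset.Ioc n (n + k), D.C j + D.C (n + k + 1) := by
      rw [← add_assoc n k 1, ← Finset.insert_Ioc_right_eq_Ioc_add_one (by omega),
        Finset.sum_insert (by simp), add_comm (D.C _)]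
      exact (add_assoc _ _ _).symm
    rw [hsum]
    constructor
    · exact (Finset.add_subset_add_right ih.1).trans (D.add_subset (n + k))
    · rintro _ ⟨w, hw, rfl⟩
      obtain ⟨p, hp, c, hc, hpc⟩ := Finset.mem_add.1 (Finset.mem_coe.1 hw)
      have hw' := w.next_prev (n := n + k) (ih.1 hp) hc hpc.symm
      rw [← hw']
      change D.incl (n + k + 1) _ ∈ _
      rw [incl_next]
      exact ih.2 ⟨w.prev (n := n + k) (ih.1 hp) hc, hp, rfl⟩

theorem cardProd_add (n k : ℕ) :
    D.cardProd (n + k) = D.cardProd n * ∏ j ∈ Finset.Ioc n (n + k), ((D.C j).card : ℝ≥0∞) := by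
  induction k with
  | zero => simp
  | succ k ih =>
    rw [← add_assoc, cardProd_succ, ih, mul_assoc,
      ← Finset.insert_Ioc_right_eq_Ioc_add_one (by omega : n ≤ n + k),
      Finset.prod_insert (by simp), mul_comm ((D.C (n + k + 1)).card : ℝ≥0∞)]

/-- The ratio is the proportion of the cylinders `[f]_{n+k}` composing `X_n` with `g + f ∈ F_{n+k}`,
and these cylinders lie in the domain of `T_g`. -/
theorem le_measure_range_inter_dom (g : ℤ) (n k : ℕ) :
    ENNReal.ofReal ((((({g} : Finset ℤ) + D.F n + ∑ j ∈ Finset.Ioc n (n + k), D.C j) ∩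
      D.F (n + k)).card : ℝ) /
        (((D.F n).card : ℝ) * ∏ j ∈ Finset.Ioc n (n + k), ((D.C j).card : ℝ))) *
      D.measure (range (D.incl n)) ≤ D.measure (range (D.incl n) ∩ D.dom g) := by
  classical
  set P := D.F n + ∑ j ∈ Finset.Ioc n (n + k), D.C j with hP
  obtain ⟨h1, h2⟩ := D.subset_and_cylinder_subset n k
  set Q := P.filter fun f => g + f ∈ D.F (n + k) with hQ
  have hQP : (Q : Set ℤ) ⊆ P := Finset.coe_subset.2 (Finset.filter_subset _ _)
  have hsub : D.cylinder (n + k) Q ⊆ range (D.incl n) ∩ D.dom g := by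
    have h3 : D.cylinder (n + k) Q ⊆ D.cylinder (n + k) P := image_mono fun u hu => hQP hu
    refine subset_inter (h3.trans h2) ?_
    rintro _ ⟨u, hu, rfl⟩
    exact mem_iUnion.2 ⟨n + k, u, (Finset.mem_filter.1 (Finset.mem_coe.1 hu)).2, rfl⟩
  have hcard : ((({g} : Finset ℤ) + D.F n + ∑ j ∈ Finset.Ioc n (n + k), D.C j) ∩
      D.F (n + k)).card = (Q ∩ D.F (n + k)).card := by
    have hQF : Q ∩ D.F (n + k) = Q :=
      Finset.inter_eq_left.2 ((Finset.filter_subset _ _).trans h1)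
    rw [hQF, add_assoc, ← hP]
    symm
    refine Finset.card_bij (fun f _ => g + f) ?_ (fun _ _ _ _ h => add_left_cancel h) ?_
    · intro f hf
      have := Finset.mem_filter.1 hf
      exact Finset.mem_inter.2
        ⟨Finset.add_mem_add (Finset.mem_singleton_self g) this.1, this.2⟩
    · intro f hf
      obtain ⟨hf1, hf2⟩ := Finset.mem_inter.1 hf
      obtain ⟨a, ha, p, hp, rfl⟩ := Finset.mem_add.1 hf1
      rw [Finset.mem_singleton] at ha
      subst ha
      exact ⟨p, Finset.mem_filter.2 ⟨hp, hf2⟩, rfl⟩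
  have hF0 : ((D.F n).card : ℝ≥0∞) ≠ 0 := by
    exact_mod_cast (Finset.card_pos.2 (D.F_nonempty n)).ne'
  have hC0 : ∀ j ∈ Finset.Ioc n (n + k), ((D.C j).card : ℝ) ≠ 0 := by
    intro j hj
    obtain ⟨i, rfl⟩ := Nat.exists_eq_add_of_lt (Finset.mem_Ioc.1 hj).1
    exact_mod_cast (Finset.card_pos.2 (D.C_nonempty (n + i))).ne'
  have hprod : ENNReal.ofReal (∏ j ∈ Finset.Ioc n (n + k), ((D.C j).card : ℝ)) =
      ∏ j ∈ Finset.Ioc n (n + k), ((D.C j).card : ℝ≥0∞) := by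
    rw [ENNReal.ofReal_prod_of_nonneg fun _ _ => Nat.cast_nonneg _]
    simp
  have hprod0 : 0 < ∏ j ∈ Finset.Ioc n (n + k), ((D.C j).card : ℝ) :=
    Finset.prod_pos fun j hj => lt_of_le_of_ne (Nat.cast_nonneg _) (hC0 j hj).symm
  have hFr : (0 : ℝ) < (D.F n).card := by exact_mod_cast Finset.card_pos.2 (D.F_nonempty n)
  refine le_trans (le_of_eq ?_) (measure_mono hsub)
  rw [D.measure_cylinder, D.measure_range_incl, hcard, ENNReal.ofReal_div_of_pos (mul_pos hFr hprod0),
    ENNReal.ofReal_mul (Nat.cast_nonneg _), hprod, ENNReal.ofReal_natCast, ENNReal.ofReal_natCast,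
    D.cardProd_add n k]
  have hp0 : ∏ j ∈ Finset.Ioc n (n + k), ((D.C j).card : ℝ≥0∞) ≠ 0 := by
    rw [← hprod]
    exact (ENNReal.ofReal_pos.2 hprod0).ne'
  have hpt : ∏ j ∈ Finset.Ioc n (n + k), ((D.C j).card : ℝ≥0∞) ≠ ∞ :=
    ENNReal.prod_ne_top fun _ _ => ENNReal.natCast_ne_top _
  rw [ENNReal.mul_inv (Or.inl (D.cardProd_ne_zero n)) (Or.inl (D.cardProd_ne_top n)),
    div_eq_mul_inv, ENNReal.mul_inv (Or.inl hF0) (Or.inl (ENNReal.natCast_ne_top _))]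
  calc _ = ((D.F n).card : ℝ≥0∞)⁻¹ * (D.F n).card * ((D.cardProd n)⁻¹ *
        (∏ j ∈ Finset.Ioc n (n + k), ((D.C j).card : ℝ≥0∞))⁻¹ * ((Q ∩ D.F (n + k)).card)) := by
        ring
    _ = _ := by rw [ENNReal.inv_mul_cancel hF0 (ENNReal.natCast_ne_top _), one_mul]

theorem IsAlmostEverywhereDefined.measure_compl_core {D : CFSequence}
    (H : D.IsAlmostEverywhereDefined) : D.measure D.coreᶜ = 0 := by
  rw [core, compl_iInter]
  refine measure_iUnion_null fun g => ?_
  have hn : ∀ n, 0 < n → D.measure (range (D.incl n) \ D.dom g) = 0 := by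
    intro n hn
    have h1 := (ENNReal.tendsto_ofReal (H g n hn)).comp (tendsto_add_atTop_nat n)
    rw [ENNReal.ofReal_one] at h1
    have h2 := ENNReal.Tendsto.mul_const h1
      (Or.inl one_ne_zero : (1 : ℝ≥0∞) ≠ 0 ∨ D.measure (range (D.incl n)) ≠ ∞)
    rw [one_mul] at h2
    have h3 : D.measure (range (D.incl n)) ≤ D.measure (range (D.incl n) ∩ D.dom g) := by
      refine le_of_tendsto' h2 fun k => ?_
      have := D.le_measure_range_inter_dom g n k
      rw [add_comm n k] at this
      exact this
    have h4 : D.measure (range (D.incl n) ∩ D.dom g) ≠ ∞ :=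
      ((measure_mono inter_subset_left).trans_lt (D.measure_range_incl_lt_top n)).ne
    have h5 := measure_inter_add_sdiff (μ := D.measure) (range (D.incl n)) (D.measurableSet_dom g)
    have h6 : D.measure (range (D.incl n) ∩ D.dom g) +
        D.measure (range (D.incl n) \ D.dom g) ≤ D.measure (range (D.incl n) ∩ D.dom g) + 0 := by
      rw [h5, add_zero]
      exact h3
    exact nonpos_iff_eq_zero.1 ((ENNReal.add_le_add_iff_left h4).1 h6)
  -- The hypothesis concerns only positive levels, so the space is exhausted by `X_{n+1}`; nothing
  -- is lost because `X_n ⊆ X_{n+1}`.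
  refine measure_mono_null (t := ⋃ n, range (D.incl (n + 1)) \ D.dom g) (fun x hx => ?_)
    (measure_iUnion_null fun n => hn (n + 1) n.succ_pos)
  obtain ⟨n, u, rfl⟩ := D.exists_incl x
  exact mem_iUnion.2 ⟨n, D.monotone_range_incl n.le_succ (mem_range_self u), hx⟩

theorem IsAlmostEverywhereDefined.coreMeasure_preimage {D : CFSequence}
    (H : D.IsAlmostEverywhereDefined) (A : Set D.Space) :
    D.coreMeasure (Subtype.val ⁻¹' A) = D.measure A := by
  rw [coreMeasure_apply, Subtype.image_preimage_coe]
  refine measure_congr ?_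
  have h : ∀ᵐ x ∂D.measure, x ∈ D.core := mem_ae_iff.2 H.measure_compl_core
  filter_upwards [h] with x hx
  exact propext ⟨fun h => h.2, fun h => ⟨hx, h⟩⟩

end AlmostEverywhere

end CFSequence

/-! ### The towers of a `(C,F)`-action with interval shapes. -/

namespace CFSequence

variable {D : CFSequence} {h : ℕ → ℕ}

/-- The base `[0]_n` of the `n`-th tower, as a subset of the domain of the action. -/
def base (D : CFSequence) (n : ℕ) : Set D.core := Subtype.val ⁻¹' D.cylinder n {0}

theorem measurableSet_preimage_cylinder (D : CFSequence) (n : ℕ) (A : Set ℤ) :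
    MeasurableSet (Subtype.val ⁻¹' D.cylinder n A : Set D.core) :=
  measurable_subtype_coe (D.measurableSet_cylinder n A)

theorem vadd_base {n : ℕ} (h0 : (0 : ℤ) ∈ D.F n) {k : ℤ} (hk : k ∈ D.F n) :
    k +ᵥ D.base n = Subtype.val ⁻¹' D.cylinder n {k} := by
  ext x
  rw [Set.mem_vadd_set_iff_neg_vadd_mem]
  constructor
  · rintro ⟨u, hu, hux⟩
    have hu0 : u.1.1 = 0 := hu
    have hk' : k + u.1.1 ∈ D.F n := by rwa [hu0, add_zero]
    have h1 := D.coe_vadd_eq k (-k +ᵥ x) u hk' hux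
    rw [vadd_neg_vadd] at h1
    rw [mem_preimage, h1]
    exact ⟨_, show k + u.1.1 = k by rw [hu0, add_zero], rfl⟩
  · rintro ⟨u, hu, hux⟩
    have huk : u.1.1 = k := hu
    have hk' : -k + u.1.1 ∈ D.F n := by rwa [huk, neg_add_cancel]
    have h1 := D.coe_vadd_eq (-k) x u hk' hux
    rw [base, mem_preimage, h1]
    exact ⟨_, show -k + u.1.1 = 0 by rw [huk, neg_add_cancel], rfl⟩

theorem height_pos (hF : ∀ n, D.F n = Finset.Ico (0 : ℤ) (h n)) (n : ℕ) : 0 < h n := by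
  obtain ⟨f, hf⟩ := D.F_nonempty n
  rw [hF, Finset.mem_Ico] at hf
  omega

/-- Two disjoint translates of `F_n` fit into `F_{n+1}`, so each height is at least twice the
previous one. -/
theorem strictMono_height (hF : ∀ n, D.F n = Finset.Ico (0 : ℤ) (h n)) : StrictMono h := by
  refine strictMono_nat_of_lt_succ fun n => ?_
  have hcard : ∀ n, (D.F n).card = h n := fun n => by simp [hF]
  obtain ⟨c, hc, c', hc', hne⟩ := Finset.one_lt_card.1 (D.one_lt_card n)
  have h1 : D.F n + {c} ∪ (D.F n + {c'}) ⊆ D.F (n + 1) :=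
    (Finset.union_subset (Finset.add_subset_add_left (Finset.singleton_subset_iff.2 hc))
      (Finset.add_subset_add_left (Finset.singleton_subset_iff.2 hc'))).trans (D.add_subset n)
  have h2 := Finset.card_le_card h1
  rw [Finset.card_union_of_disjoint (D.disjoint n c hc c' hc' hne), Finset.card_add_singleton,
    Finset.card_add_singleton, hcard, hcard] at h2
  have := height_pos hF n
  omega

theorem vadd_base_of_lt (hF : ∀ n, D.F n = Finset.Ico (0 : ℤ) (h n)) {n i : ℕ} (hi : i < h n) :
    (i : ℤ) +ᵥ D.base n = Subtype.val ⁻¹' D.cylinder n {(i : ℤ)} := by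
  refine vadd_base ?_ ?_ <;> rw [hF, Finset.mem_Ico] <;> omega

theorem isTower_base (hF : ∀ n, D.F n = Finset.Ico (0 : ℤ) (h n)) (n : ℕ) :
    IsTower (D.base n) (h n) := by
  intro i hi j hj hij
  rw [vadd_base_of_lt hF hi, vadd_base_of_lt hF hj]
  refine Disjoint.preimage _ (Set.disjoint_left.2 ?_)
  rintro _ ⟨u, hu, rfl⟩ ⟨v, hv, huv⟩
  obtain rfl := D.incl_injective n huv
  have h1 : v.1.1 = i := hu
  have h2 : v.1.1 = j := hv
  omega

theorem levels_base (hF : ∀ n, D.F n = Finset.Ico (0 : ℤ) (h n)) {n : ℕ} {I : Finset ℕ}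
    (hI : I ⊆ Finset.range (h n)) :
    levels (D.base n) I = Subtype.val ⁻¹' D.cylinder n {f | ∃ i ∈ I, (i : ℤ) = f} := by
  ext x
  rw [mem_levels]
  constructor
  · rintro ⟨i, hi, hx⟩
    rw [vadd_base_of_lt hF (Finset.mem_range.1 (hI hi))] at hx
    obtain ⟨u, hu, hux⟩ := hx
    exact ⟨u, ⟨i, hi, Eq.symm hu⟩, hux⟩
  · rintro ⟨u, ⟨i, hi, hiu⟩, hux⟩
    refine ⟨i, hi, ?_⟩
    rw [vadd_base_of_lt hF (Finset.mem_range.1 (hI hi))]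
    exact ⟨u, hiu.symm, hux⟩

theorem exists_levels_base_eq (hF : ∀ n, D.F n = Finset.Ico (0 : ℤ) (h n)) {n : ℕ} {A : Set ℤ}
    (hA : A ⊆ D.F n) : ∃ I ⊆ Finset.range (h n),
      levels (D.base n) I = Subtype.val ⁻¹' D.cylinder n A := by
  classical
  have hI : (Finset.range (h n)).filter (fun i : ℕ => (i : ℤ) ∈ A) ⊆ Finset.range (h n) :=
    Finset.filter_subset _ _
  refine ⟨_, hI, ?_⟩
  rw [levels_base hF hI]
  congr 2
  ext f
  constructor
  · rintro ⟨i, hi, rfl⟩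
    exact (Finset.mem_filter.1 hi).2
  · intro hf
    have h1 := Finset.mem_coe.1 (hA hf)
    rw [hF, Finset.mem_Ico] at h1
    refine ⟨f.toNat, Finset.mem_filter.2 ⟨Finset.mem_range.2 (by omega), ?_⟩, by omega⟩
    rwa [Int.toNat_of_nonneg h1.1]

theorem coreMeasure_base_le (D : CFSequence) (n : ℕ) :
    D.coreMeasure (D.base n) ≤ (D.cardProd n)⁻¹ := by
  refine (D.coreMeasure_preimage_le _).trans ?_
  have h1 := D.measure_cylinder n {0}
  rw [Finset.coe_singleton] at h1
  rw [h1]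
  calc (D.cardProd n)⁻¹ * (({0} ∩ D.F n : Finset ℤ).card : ℝ≥0∞)
      ≤ (D.cardProd n)⁻¹ * 1 := by
        gcongr
        exact_mod_cast (Finset.card_le_card Finset.inter_subset_left).trans_eq
          (Finset.card_singleton 0)
    _ = _ := mul_one _

theorem tendsto_coreMeasure_base (D : CFSequence) :
    Tendsto (fun n => D.coreMeasure (D.base n)) atTop (𝓝 0) := by
  have h1 : Tendsto (fun n : ℕ => ((2 : ℝ≥0∞)⁻¹) ^ n) atTop (𝓝 0) :=
    ENNReal.tendsto_pow_atTop_nhds_zero_of_lt_one (by simp)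
  refine tendsto_of_tendsto_of_tendsto_of_le_of_le tendsto_const_nhds h1
    (fun _ => zero_le) fun n => (D.coreMeasure_base_le n).trans ?_
  rw [← ENNReal.inv_pow]
  exact ENNReal.inv_le_inv.2 (D.two_pow_le_cardProd n)

/-- Borel sets of finite measure are approximated by cylinders. -/
theorem exists_cylinder_symmDiff_lt (D : CFSequence) {A : Set D.Space} (hA : MeasurableSet A)
    (hAfin : D.measure A ≠ ∞) {ε : ℝ≥0∞} (hε : 0 < ε) :
    ∃ n E, D.measure (symmDiff A (D.cylinder n E)) < ε := by
  have hε2 : 0 < ε / 2 := ENNReal.div_pos hε.ne' (by simp)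
  -- The ring approximation is used for a finite measure: all but `ε / 2` of `A` lies in some `X_N`,
  -- and the approximation takes place inside it.
  have hlim : Tendsto (fun n => D.measure (A \ range (D.incl n))) atTop (𝓝 0) := by
    have h1 := tendsto_measure_iInter_atTop (μ := D.measure)
      (s := fun n => A \ range (D.incl n))
      (fun n => (hA.diff (D.measurableSet_range_incl n)).nullMeasurableSet)
      (fun n m hnm => sdiff_subset_sdiff_right (D.monotone_range_incl hnm))
      ⟨0, ((measure_mono sdiff_subset).trans_lt hAfin.lt_top).ne⟩
    rwa [← sdiff_iUnion, D.iUnion_range_incl, sdiff_univ, measure_empty] at h1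
  obtain ⟨N, hN⟩ := (hlim.eventually (gt_mem_nhds hε2)).exists
  have : IsFiniteMeasure (D.measure.restrict (range (D.incl N))) :=
    ⟨by simpa using D.measure_range_incl_lt_top N⟩
  obtain ⟨t, ht, htA⟩ := exists_measure_symmDiff_lt_of_generateFrom_isSetRing
    (μ := D.measure.restrict (range (D.incl N))) D.isSetRing_cylinders
    ⟨{range (D.incl N)}, countable_singleton _, by
      rintro _ rfl
      exact ⟨N, univ, (D.cylinder_univ N).symm⟩, by
      rw [sUnion_singleton, Measure.restrict_apply (D.measurableSet_range_incl N).compl,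
        compl_inter_self, measure_empty]⟩ D.borel_eq_generateFrom_cylinders hA hε2
  have htN := D.isSetRing_cylinders.inter_mem ht ⟨N, univ, (D.cylinder_univ N).symm⟩
  obtain ⟨n, E, hE⟩ := htN
  refine ⟨n, E, ?_⟩
  rw [← hE]
  calc D.measure (symmDiff A (t ∩ range (D.incl N)))
      ≤ D.measure (A \ range (D.incl N) ∪ symmDiff t A ∩ range (D.incl N)) := by
        refine measure_mono fun x hx => ?_
        rcases hx with ⟨hxA, hxt⟩ | ⟨⟨hxt, hxN⟩, hxA⟩
        · by_cases hxN : x ∈ range (D.incl N)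
          · exact Or.inr ⟨Or.inr ⟨hxA, fun h => hxt ⟨h, hxN⟩⟩, hxN⟩
          · exact Or.inl ⟨hxA, hxN⟩
        · exact Or.inr ⟨Or.inl ⟨hxt, hxA⟩, hxN⟩
    _ ≤ D.measure (A \ range (D.incl N)) + D.measure (symmDiff t A ∩ range (D.incl N)) :=
        measure_union_le _ _
    _ < ε / 2 + ε / 2 := by
        refine ENNReal.add_lt_add hN ?_
        rwa [Measure.restrict_apply' (D.measurableSet_range_incl N)] at htA
    _ = ε := ENNReal.add_halves ε

/-- A cylinder approximating the set at one level is a union of tower levels at every later stage,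
so the approximation persists for all large indices. -/
theorem rankOneTowers (hF : ∀ n, D.F n = Finset.Ico (0 : ℤ) (h n)) :
    RankOneTowers D.coreMeasure D.base h where
  measurableSet n := D.measurableSet_preimage_cylinder n {0}
  ne_top n := ((D.coreMeasure_base_le n).trans_lt
    (ENNReal.inv_lt_top.2 (D.cardProd_ne_zero n).bot_lt)).ne
  isTower := isTower_base hF
  approx A hA hAfin ε hε := by
    have hA' := D.measurableEmbedding_val_core.measurableSet_image.2 hA
    rw [coreMeasure_apply] at hAfin
    obtain ⟨n, E, hE⟩ := D.exists_cylinder_symmDiff_lt hA' hAfin.ne hε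
    filter_upwards [eventually_ge_atTop n] with m hm
    obtain ⟨E', hE'F, hE'⟩ := D.exists_cylinder_eq hm E
    obtain ⟨I, hI, hlev⟩ := exists_levels_base_eq hF hE'F
    refine ⟨I, hI, lt_of_le_of_lt ?_ hE⟩
    rw [hlev, hE', coreMeasure_apply]
    refine measure_mono ?_
    rintro _ ⟨x, ⟨hx1, hx2⟩ | ⟨hx1, hx2⟩, rfl⟩
    · exact Or.inl ⟨mem_image_of_mem _ hx1, hx2⟩
    · refine Or.inr ⟨hx1, fun hx => hx2 ?_⟩
      obtain ⟨y, hy, hyx⟩ := hx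
      rwa [← Subtype.ext hyx]

theorem coreMeasure_base_zero (H : D.IsAlmostEverywhereDefined) :
    D.coreMeasure (D.base 0) = 1 := by
  have h1 := D.measure_cylinder 0 {0}
  rw [Finset.coe_singleton] at h1
  rw [base, H.coreMeasure_preimage, h1, D.F_zero]
  simp [cardProd]

/-- The cylinder `[0]_0` is exactly a union of levels of every tower, so the covering measure is
`1`. The number of levels times the measure of the base is therefore `1`, and it tends to infinity
as the bases shrink. -/
theorem towerCover (hF : ∀ n, D.F n = Finset.Ico (0 : ℤ) (h n))
    (H : D.IsAlmostEverywhereDefined) : TowerCover D.coreMeasure (D.base 0) h := by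
  have hI : ∀ n, ∃ I ⊆ Finset.range (h n), levels (D.base n) I = D.base 0 := by
    intro n
    obtain ⟨E, hEF, hE⟩ := D.exists_cylinder_eq n.zero_le {0}
    obtain ⟨I, hI, hlev⟩ := exists_levels_base_eq hF hEF
    exact ⟨I, hI, by rw [hlev, ← hE]; rfl⟩
  choose I hIh hI using hI
  have hT := rankOneTowers hF
  have h1 := coreMeasure_base_zero H
  refine ⟨hT.measurableSet 0, by simp [h1], by simp [h1], D.base, I, 1, fun n => ?_, ?_⟩
  · refine ⟨hT.measurableSet n, hT.ne_top n, hT.isTower n, hIh n, (hI n).ge, ?_⟩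
    rw [hI, Measure.real, h1, ENNReal.toReal_one]
  · rw [tendsto_atTop]
    intro N
    have h2 : Tendsto (fun n => (N : ℝ≥0∞) * D.coreMeasure (D.base n)) atTop (𝓝 0) := by
      simpa using ENNReal.Tendsto.const_mul D.tendsto_coreMeasure_base
        (Or.inr (ENNReal.natCast_ne_top N))
    filter_upwards [h2.eventually (gt_mem_nhds one_pos)] with n hn
    by_contra! hlt
    have h3 := measure_levels (μ := D.coreMeasure) (hT.measurableSet n) (hT.isTower n) (hIh n)
    rw [hI, h1] at h3
    refine absurd hn (not_lt.2 ?_)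
    rw [h3]
    gcongr

theorem measureReal_inter_image (D : CFSequence) (A B : Set D.Space) (k : ℤ) :
    D.measure.real (A ∩ D.image k B) =
      D.coreMeasure.real (Subtype.val ⁻¹' A ∩ (k +ᵥ (Subtype.val ⁻¹' B : Set D.core))) := by
  rw [Measure.real, Measure.real, coreMeasure_apply, inter_comm (Subtype.val ⁻¹' A),
    image_inter_preimage, image, inter_comm]

theorem tendsto_div_of_subset_cylinder (hF : ∀ n, D.F n = Finset.Ico (0 : ℤ) (h n))
    (H : D.IsAlmostEverywhereDefined) {A B : Set D.Space} (hA : MeasurableSet A)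
    (hB : MeasurableSet B) (hA0 : A ⊆ D.cylinder 0 {0}) (hB0 : B ⊆ D.cylinder 0 {0}) :
    Tendsto (fun l =>
      (∑ k ∈ Finset.range (h l), D.measure.real (A ∩ D.image k B)) /
      (∑ k ∈ Finset.range (h l),
        D.measure.real (D.cylinder 0 {0} ∩ D.image k (D.cylinder 0 {0}))))
      atTop (𝓝 (D.measure.real A * D.measure.real B)) := by
  have := (rankOneTowers hF).ergodicVAdd
  have h1 := (towerCover hF H).tendsto_returnSum (A := Subtype.val ⁻¹' A)
    (B := Subtype.val ⁻¹' B) (measurable_subtype_coe hA) (measurable_subtype_coe hB)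
    (preimage_mono hA0) (preimage_mono hB0)
  have h2 : D.coreMeasure.real (D.base 0) = 1 := by
    rw [Measure.real, coreMeasure_base_zero H, ENNReal.toReal_one]
  have h3 : ∀ E : Set D.Space, D.coreMeasure.real (Subtype.val ⁻¹' E) = D.measure.real E :=
    fun E => by rw [Measure.real, Measure.real, H.coreMeasure_preimage]
  rw [h3, h3] at h1
  refine h1.congr fun l => ?_
  simp_rw [measureReal_inter_image, h2]
  rw [one_pow, div_one, one_div, inv_mul_eq_div]
  rfl

end CFSequence

/-! ### The two statements combined. -/

theorem theorem2p4 :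
    -- rank-one `(C,F)`-actions of `ℤ`
    (∀ (D : CFSequence) (h : ℕ → ℕ),
      (∀ n, D.F n = Finset.Ico (0 : ℤ) (h n)) →
      D.IsAlmostEverywhereDefined →
      (∀ A B : Set D.Space, MeasurableSet A → MeasurableSet B →
        A ⊆ D.cylinder 0 {0} → B ⊆ D.cylinder 0 {0} →
        Tendsto (fun l =>
          (∑ k ∈ Finset.range (h l), D.measure.real (A ∩ D.image k B)) /
          (∑ k ∈ Finset.range (h l),
            D.measure.real (D.cylinder 0 {0} ∩ D.image k (D.cylinder 0 {0}))))
          atTop (𝓝 (D.measure.real A * D.measure.real B))) ∧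
      IsSubsequenceWeaklyRationallyErgodic D.coreMeasure ∧
      IsNonSquashable D.coreMeasure) ∧
    -- rank-one actions of `ℤ` on standard `σ`-finite non-atomic measure spaces
    (∀ (X : Type*) [MeasurableSpace X] [StandardBorelSpace X] [AddAction ℤ X]
      [MeasurableConstVAdd ℤ X] (μ : Measure X) [SigmaFinite μ] [NullSingletonClass μ]
      [VAddInvariantMeasure ℤ X μ],
      μ ≠ 0 → IsRankOne μ →
      IsSubsequenceWeaklyRationallyErgodic μ ∧ IsNonSquashable μ) := by
  refine ⟨fun D h hF H => ?_, fun X _ _ _ _ μ _ _ _ hμ hrank => ?_⟩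
  · have hT := CFSequence.rankOneTowers hF
    have hY := CFSequence.towerCover hF H
    have := hT.ergodicVAdd
    exact ⟨fun A B hA hB hA0 hB0 => CFSequence.tendsto_div_of_subset_cylinder hF H hA hB hA0 hB0,
      ⟨h, CFSequence.strictMono_height hF,
        hT.isWeaklyRationallyErgodicAlong D.tendsto_coreMeasure_base hY⟩,
      hY.isNonSquashable⟩
  · obtain ⟨B, h, hT⟩ := hrank.exists_towers
    have hB := hT.tendsto_base fun δ hδ => exists_measure_pos_lt hμ hδ
    obtain ⟨Y, k, hk, hY⟩ := hT.exists_towerCover hB hμ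
    have := hT.ergodicVAdd
    exact ⟨⟨k, hk, hT.isWeaklyRationallyErgodicAlong hB hY⟩, hY.isNonSquashable⟩
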